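/- Let $G$ be a second countable, locally compact (Hausdorff), unimodular, amenable group with Haar measure $\mu$; amenable means that $L^\infty(G)$ carries a left-invariant mean. All representations act on complex Hilbert spaces, inner products are linear in the first variable, unitary representations are strongly continuous, and irreducible ones are nonzero. A (two-sided) group Følner sequence is a sequence of compact sets $F_n\subset G$ with $\mu(F_n)>0$ such that $\sup_{g,h\in C}\mu(gF_nh^{-1}\,\Delta\,F_n)/\mu(F_n)\to 0$ for every compact $C\subset G$. An irreducible unitary representation $(\pi,V_\pi)$ is c-tempered with Følner sequence $\{F_n\}$ if the $F_n$ are measurable pre-compact sets containing a neighbourhood of $1$ and there is a unit vector $v_0\in V_\pi$ such that for all $v_1,v_2\in V_\pi$ and all compact $C\subset G$ $$\limsup_{n\to\infty}\frac{\int_{F_n}|\langle\pi(g)v_1,v_2\rangle|^2d\mu(g)}{\int_{F_n}|\langle\pi(g)v_0,v_0\rangle|^2d\mu(g)}<\infty,\qquad \lim_{n\to\infty}\frac{\sup_{g_1,g_2\in C}\int_{g_2^{-1}F_ng_1\Delta F_n}|\langle\pi(g)v_1,v_2\rangle|^2d\mu(g)}{\int_{F_n}|\langle\pi(g)v_0,v_0\rangle|^2d\mu(g)}=0.$$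 Sequences $\{a_n\},\{b_n\}$ are asymptotically equivalent if $0<\liminf a_n/b_n\le\limsup a_n/b_n<\infty$. For a representation $\pi$ and a group Følner sequence $\{F_n\}$ let $(\ast)$ be the condition: $\pi$ is c-tempered with Følner sequence $\{F_n\}$, and for all nonzero $v,w\in V_\pi$ the sequence $\{\int_{F_n}|\langle\pi(g)v,w\rangle|^2d\mu(g)\}_n$ is asymptotically equivalent to $\{\mu(F_n)\}_n$. Then there exists a group Følner sequence $\{F_n\}_n$ of $G$ with the following properties. 1. An irreducible unitary representation $\pi$ of $G$ satisfies $(\ast)$ with $\{F_n\}$ if and only if $\pi$ is finite-dimensional. 2. For all finite-dimensional irreducible unitary representations $(\pi,V_\pi)$, $(\rho,V_\rho)$ of $G$ and all $v_1,v_2\in V_\pi$, $w_1,w_2\in V_\rho$, $$\lim_{n\to\infty}\frac{1}{\mu(F_n)}\int_{F_n}\langle\pi(g)v_1,v_2\rangle\overline{\langle\rho(g)w_1,w_2\rangle}\,d\mu(g)=\begin{cases}\frac{1}{\dim V_\pi}\langle v_1,w_1\rangle\overline{\langle v_2,w_2\rangle}&\text{if }\pi=\rho,\\ 0&\text{if }\pi\not\cong\rho.\end{cases}$$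 3. For every finite-dimensional irreducible unitary representation $(\pi,V_\pi)$ of $G$, in the weak operator topology on the operators of $V_\pi\otimes V_\pi$, $$\lim_{n\to\infty}\frac{1}{\mu(F_n)}\int_{F_n}\pi(g^{-1})\otimes\pi(g)\,d\mu(g)=\frac{1}{\dim V_\pi}F,$$ where $F$ is the flip operator $F(v\otimes w)=w\otimes v$. Moreover, an irreducible unitary representation that satisfies $(\ast)$ with any group Følner sequence whatsoever is finite-dimensional. -/

import Mathlib

open MeasureTheory Filter Topology
open scoped ENNReal symmDiff TensorProduct ComplexConjugate

universe u v

noncomputable section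

/-- A unitary representation of the topological group `G` on the complex Hilbert space `V`:
a homomorphism to the unitary operators of `V`, continuous in the strong operator topology. -/
structure UnitaryRep (G : Type*) [Group G] [TopologicalSpace G]
    (V : Type*) [NormedAddCommGroup V] [InnerProductSpace ℂ V] [CompleteSpace V] where
  toHom : G →* (V ≃ₗᵢ[ℂ] V)
  continuous_apply : ∀ v : V, Continuous fun g => toHom g v

namespace UnitaryRep

variable {G : Type*} [Group G] [TopologicalSpace G]
variable {V : Type*} [NormedAddCommGroup V] [InnerProductSpace ℂ V] [CompleteSpace V]
variable {W : Type*} [NormedAddCommGroup W] [InnerProductSpace ℂ W] [CompleteSpace W]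

/-- `π` is irreducible: `V ≠ 0` and the only closed invariant subspaces are `0` and `V`. -/
def IsIrreducible (π : UnitaryRep G V) : Prop :=
  Nontrivial V ∧ ∀ K : Submodule ℂ V, IsClosed (K : Set V) →
    (∀ g, ∀ v ∈ K, π.toHom g v ∈ K) → K = ⊥ ∨ K = ⊤

/-- Unitary equivalence of representations. -/
def Equivalent (π : UnitaryRep G V) (ρ : UnitaryRep G W) : Prop :=
  ∃ U : V ≃ₗᵢ[ℂ] W, ∀ g v, U (π.toHom g v) = ρ.toHom g (U v)

/-- The matrix coefficient `g ↦ ⟨π(g)v, w⟩`, where `⟨·,·⟩` is linear in the first variable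
(Mathlib's `inner ℂ` is linear in the second one). -/
def coeff (π : UnitaryRep G V) (v w : V) (g : G) : ℂ :=
  inner ℂ w (π.toHom g v)

/-- `∫_S |⟨π(g)v, w⟩|² dμ(g)`, as an extended non-negative real. -/
def energy [MeasurableSpace G] (μ : Measure G) (π : UnitaryRep G V) (S : Set G) (v w : V) :
    ℝ≥0∞ :=
  ∫⁻ g in S, ‖π.coeff v w g‖ₑ ^ 2 ∂μ

/-- `π` is c-tempered with Følner sequence `F`. -/
def IsCTempered [MeasurableSpace G] (μ : Measure G) (π : UnitaryRep G V) (F : ℕ → Set G) :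
    Prop :=
  (∀ n, MeasurableSet (F n) ∧ IsCompact (closure (F n)) ∧ F n ∈ 𝓝 (1 : G)) ∧
  ∃ v₀ : V, ‖v₀‖ = 1 ∧
    (∀ v₁ v₂ : V,
      limsup (fun n => π.energy μ (F n) v₁ v₂ / π.energy μ (F n) v₀ v₀) atTop < ∞) ∧
    (∀ v₁ v₂ : V, ∀ C : Set G, IsCompact C →
      Tendsto (fun n =>
        (⨆ g₁ ∈ C, ⨆ g₂ ∈ C,
          π.energy μ (((fun x => g₂⁻¹ * x * g₁) '' F n) ∆ F n) v₁ v₂)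
            / π.energy μ (F n) v₀ v₀) atTop (𝓝 0))

/-- The unitary operator `π(g⁻¹) ⊗ π(g)` on `V ⊗ V`. For finite-dimensional `V` the algebraic
tensor product, with its inner product, is the Hilbert tensor product. -/
def braidTwist (π : UnitaryRep G V) (g : G) : (V ⊗[ℂ] V) →L[ℂ] (V ⊗[ℂ] V) :=
  (TensorProduct.congrIsometry (π.toHom g⁻¹) (π.toHom g)).toContinuousLinearEquiv

end UnitaryRep

/-- The braiding (flip) operator `v ⊗ w ↦ w ⊗ v`. -/
def braiding (V : Type*) [NormedAddCommGroup V] [InnerProductSpace ℂ V] :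
    (V ⊗[ℂ] V) →L[ℂ] (V ⊗[ℂ] V) :=
  (TensorProduct.commIsometry ℂ V V).toContinuousLinearEquiv

/-- Asymptotic equivalence: `0 < liminf aₙ/bₙ ≤ limsup aₙ/bₙ < ∞`. -/
def AsympEquiv (a b : ℕ → ℝ≥0∞) : Prop :=
  0 < liminf (fun n => a n / b n) atTop ∧ limsup (fun n => a n / b n) atTop < ∞

/-- Left translation `f ↦ f(g⁻¹ ·)` on `L^∞(G, μ)`. -/
def leftTranslate {G : Type*} [Group G] [MeasurableSpace G] [MeasurableMul G]
    (μ : Measure G) [μ.IsMulLeftInvariant] (g : G) (f : Lp ℝ ∞ μ) : Lp ℝ ∞ μ :=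
  Lp.compMeasurePreserving (fun x => g⁻¹ * x) (measurePreserving_mul_left μ g⁻¹) f

/-- Amenability of a locally compact group with left Haar measure `μ`: there is a left-invariant
mean, i.e. a positive normalized left-invariant linear functional, on `L^∞(G, μ)`. -/
def IsAmenable {G : Type*} [Group G] [MeasurableSpace G] [MeasurableMul G]
    (μ : Measure G) [μ.IsMulLeftInvariant] : Prop :=
  ∃ m : Lp ℝ ∞ μ →ₗ[ℝ] ℝ,
    (∀ f, 0 ≤ f → 0 ≤ m f) ∧
    m ((memLp_top_const (1 : ℝ)).toLp (fun _ : G => (1 : ℝ))) = 1 ∧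
    ∀ g f, m (leftTranslate μ g f) = m f

/-- A two-sided group Følner sequence: compact sets of positive measure such that
`μ(g F_n h⁻¹ ∆ F_n) / μ(F_n) → 0` uniformly for `g, h` in compact sets. -/
def IsGroupFolner {G : Type*} [Group G] [TopologicalSpace G] [MeasurableSpace G]
    (μ : Measure G) (F : ℕ → Set G) : Prop :=
  (∀ n, IsCompact (F n) ∧ 0 < μ (F n)) ∧
  ∀ C : Set G, IsCompact C →
    Tendsto (fun n =>
      (⨆ g ∈ C, ⨆ h ∈ C, μ (((fun x => g * x * h⁻¹) '' F n) ∆ F n)) / μ (F n))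
      atTop (𝓝 0)

end

/-! The theorem combines two independent arguments.

Representation side. For any two-sided Følner sequence the normalized integrals of products of
matrix coefficients are bounded, so they converge along every ultrafilter finer than `atTop`.
Two-sided almost invariance makes the limit a bounded form, invariant separately in the pairs (v₁,
w₁) and (v₂, w₂) (`exists_limit_form`). By Schur's lemma it vanishes for inequivalent irreducibles,
and for π against itself it is c ⟨v₁, w₁⟩ times the conjugate of ⟨v₂, w₂⟩. Summing |⟨π(g)v, eᵢ⟩|²
over an orthonormal family determines c: in finite dimension Parseval gives c = 1 / dim V for every
ultrafilter, hence a genuine limit; in general Bessel gives dim V ≤ 1 / Re c as soon as Re c > 0,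
and the lower bound in the asymptotic equivalence supplies Re c > 0. Temperedness and the flip
formula are consequences of the orthogonality relations.

Group side (`exists_isGroupFolner_mem_nhds_one`). An invariant mean and Hahn-Banach separation give
a compactly supported density f almost invariant on the left (`IsAmenable.exists_reiter`). The
correlation k(y) = ∫ f(x) f(y⁻¹x) dx is then almost invariant on both sides and largest at 1. By the
layer-cake formula some superlevel set of k is almost invariant on average over a compact set, and a
Chebyshev argument makes this uniform. Levels strictly below k(1) give neighbourhoods of 1, which
c-temperedness demands. -/

set_option linter.unusedSectionVars false

noncomputable section

/-! ### Schur's lemma and invariant sesquilinear forms. -/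

namespace UnitaryRep

variable {G : Type*} [Group G] [TopologicalSpace G]
variable {V : Type*} [NormedAddCommGroup V] [InnerProductSpace ℂ V] [CompleteSpace V]
variable {W : Type*} [NormedAddCommGroup W] [InnerProductSpace ℂ W] [CompleteSpace W]

/-- The operator `π(g)` as a bounded operator. -/
def op (π : UnitaryRep G V) (g : G) : V →L[ℂ] V :=
  (π.toHom g).toContinuousLinearEquiv

@[simp]
theorem op_apply (π : UnitaryRep G V) (g : G) (v : V) : π.op g v = π.toHom g v := rfl

theorem toHom_mul_apply (π : UnitaryRep G V) (g h : G) (v : V) :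
    π.toHom (g * h) v = π.toHom g (π.toHom h v) := by
  rw [map_mul]; rfl

theorem toHom_apply_inv_self (π : UnitaryRep G V) (g : G) (v : V) :
    π.toHom g (π.toHom g⁻¹ v) = v := by
  rw [← toHom_mul_apply, mul_inv_cancel, map_one]; rfl

theorem inner_toHom_left (π : UnitaryRep G V) (g : G) (v w : V) :
    inner ℂ (π.toHom g v) w = inner ℂ v (π.toHom g⁻¹ w) := by
  rw [← (π.toHom g).inner_map_map v, toHom_apply_inv_self]

theorem inner_toHom_right (π : UnitaryRep G V) (g : G) (v w : V) :
    inner ℂ v (π.toHom g w) = inner ℂ (π.toHom g⁻¹ v) w := by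
  rw [inner_toHom_left, inv_inv]

/-- An operator commuting with an irreducible representation is zero or injective. -/
theorem IsIrreducible.eq_zero_or_injective {π : UnitaryRep G V} {ρ : UnitaryRep G W}
    (hπ : π.IsIrreducible) (T : V →L[ℂ] W)
    (hT : ∀ g v, T (π.toHom g v) = ρ.toHom g (T v)) : T = 0 ∨ ∀ v, T v = 0 → v = 0 := by
  rcases hπ.2 (LinearMap.ker (T : V →ₗ[ℂ] W)) T.isClosed_ker (fun g v hv => by
    simp only [LinearMap.mem_ker, ContinuousLinearMap.coe_coe] at hv ⊢
    rw [hT, hv, map_zero]) with h | h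
  · right
    intro v hv
    have : v ∈ LinearMap.ker (T : V →ₗ[ℂ] W) := hv
    rwa [h, Submodule.mem_bot] at this
  · left
    ext v
    have : v ∈ LinearMap.ker (T : V →ₗ[ℂ] W) := by rw [h]; trivial
    exact this

/-- Schur's lemma for self-adjoint operators. -/
theorem IsIrreducible.exists_eq_smul_of_isSelfAdjoint {π : UnitaryRep G V}
    (hπ : π.IsIrreducible) (T : V →L[ℂ] V) (hsa : IsSelfAdjoint T)
    (hT : ∀ g v, T (π.toHom g v) = π.toHom g (T v)) : ∃ c : ℝ, T = algebraMap ℝ _ c := by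
  have := hπ.1
  have hcomm : ∀ f : ℝ → ℝ, ∀ g v, cfc f T (π.toHom g v) = π.toHom g (cfc f T v) := by
    intro f g v
    have h1 : Commute T (π.op g) := by ext v; simp [hT]
    have h2 := h1.cfc_real f
    exact DFunLike.congr_fun h2 v
  have hsub : ∀ a ∈ spectrum ℝ T, ∀ b ∈ spectrum ℝ T, ¬ a < b := by
    intro a ha b hb hab
    -- Separate two spectral points by the midpoint: the positive parts of t - c and c - t have
    -- product zero, yet each is nonzero on the spectrum. Then `cfc f T` is neither zero nor
    -- injective, although it commutes with π.
    set c := (a + b) / 2 with hc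
    set f : ℝ → ℝ := fun t => max 0 (t - c) with hf
    set k : ℝ → ℝ := fun t => max 0 (c - t) with hk
    have hfc : Continuous f := by fun_prop
    have hkc : Continuous k := by fun_prop
    have hfk : cfc f T * cfc k T = 0 := by
      rw [← cfc_mul f k T hfc.continuousOn hkc.continuousOn]
      have : (fun t => f t * k t) = fun _ => 0 := by
        funext t
        rcases le_total t c with h | h
        · simp [hf, h]
        · simp [hk, h]
      rw [this, cfc_const_zero]
    have hne : ∀ l : ℝ → ℝ, Continuous l → ∀ x ∈ spectrum ℝ T, l x ≠ 0 → cfc l T ≠ 0 := by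
      intro l hl x hx hlx h0
      have h1 : l x ∈ spectrum ℝ (cfc l T) := by
        rw [cfc_map_spectrum l T hsa hl.continuousOn]
        exact ⟨x, hx, rfl⟩
      rw [h0, spectrum.zero_eq] at h1
      exact hlx h1
    rcases hπ.eq_zero_or_injective (cfc f T) (hcomm f) with h | h
    · refine hne f hfc b hb ?_ h
      have : 0 < b - c := by rw [hc]; linarith
      simp only [hf]; rw [max_eq_right this.le]; exact this.ne'
    · refine hne k hkc a ha ?_ ?_
      · have : 0 < c - a := by rw [hc]; linarith
        simp only [hk]; rw [max_eq_right this.le]; exact this.ne'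
      · ext v
        exact h _ (DFunLike.congr_fun hfk v)
  obtain ⟨a, ha⟩ := ContinuousFunctionalCalculus.spectrum_nonempty (R := ℝ) T hsa
  refine ⟨a, ?_⟩
  have : Set.EqOn (fun x => x) (fun _ => a) (spectrum ℝ T) := fun x hx =>
    le_antisymm (not_lt.1 (hsub a ha x hx)) (not_lt.1 (hsub x hx a ha))
  rw [← cfc_const a T, ← cfc_congr this, cfc_id' ℝ T]

/-- Schur's lemma: the commutant of an irreducible unitary representation is scalar. -/
theorem IsIrreducible.exists_eq_smul {π : UnitaryRep G V}
    (hπ : π.IsIrreducible) (T : V →L[ℂ] V)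
    (hT : ∀ g v, T (π.toHom g v) = π.toHom g (T v)) : ∃ c : ℂ, ∀ v, T v = c • v := by
  have hadj : ∀ g v, star T (π.toHom g v) = π.toHom g (star T v) := by
    intro g v
    refine ext_inner_left ℂ fun w => ?_
    rw [ContinuousLinearMap.star_eq_adjoint, ContinuousLinearMap.adjoint_inner_right,
      inner_toHom_right, inner_toHom_right, ContinuousLinearMap.adjoint_inner_right, hT]
  have hre : ∀ g v, (T + star T) (π.toHom g v) = π.toHom g ((T + star T) v) := by
    intro g v; simp [hT, hadj]
  have him : ∀ g v, (Complex.I • (T - star T)) (π.toHom g v)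
      = π.toHom g ((Complex.I • (T - star T)) v) := by
    intro g v; simp [hT, hadj]
  obtain ⟨a, ha⟩ := hπ.exists_eq_smul_of_isSelfAdjoint _ (IsSelfAdjoint.add_star_self T) hre
  obtain ⟨b, hb⟩ := hπ.exists_eq_smul_of_isSelfAdjoint (Complex.I • (T - star T)) (by
    simp only [IsSelfAdjoint, star_smul, star_sub, star_star, RCLike.star_def, Complex.conj_I]
    module) him
  -- T is half of (T + T*) + (T - T*), where T + T* = a and T - T* = -ib.
  refine ⟨2⁻¹ * (a - Complex.I * b), fun v => ?_⟩
  have ha' := DFunLike.congr_fun ha v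
  have hb' := DFunLike.congr_fun hb v
  rw [Algebra.algebraMap_eq_smul_one] at ha' hb'
  simp only [add_apply, smul_apply, sub_apply, one_apply_eq_self] at ha' hb'
  have hb'' : T v - star T v = -(Complex.I * b) • v := by
    have := congrArg (fun x => -(Complex.I) • x) hb'
    simp only [smul_smul, neg_mul, Complex.I_mul_I, neg_neg, one_smul] at this
    rw [this, ← Complex.coe_smul, smul_smul]
    simp
  rw [← Complex.coe_smul] at ha'
  have h2 : (2 : ℂ) • T v = ((a : ℂ) - Complex.I * b) • v := by
    have : (2 : ℂ) • T v = (T v + star T v) + (T v - star T v) := by module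
    rw [this, ha', hb'']; module
  rw [mul_smul, ← h2, smul_smul]; simp

/-- A bounded invariant sesquilinear form between two representations comes from an
intertwining operator. -/
theorem exists_intertwiner_of_form (π : UnitaryRep G V) (ρ : UnitaryRep G W)
    (B : W → V → ℂ) (hadd₁ : ∀ w w' v, B (w + w') v = B w v + B w' v)
    (hsmul₁ : ∀ (c : ℂ) w v, B (c • w) v = conj c * B w v)
    (hadd₂ : ∀ w v v', B w (v + v') = B w v + B w v')
    (hsmul₂ : ∀ (c : ℂ) w v, B w (c • v) = c * B w v)
    (K : ℝ) (hK : ∀ w v, ‖B w v‖ ≤ K * ‖w‖ * ‖v‖)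
    (hinv : ∀ g w v, B (ρ.toHom g w) (π.toHom g v) = B w v) :
    ∃ T : V →L[ℂ] W, (∀ w v, B w v = inner ℂ w (T v)) ∧
      ∀ g v, T (π.toHom g v) = ρ.toHom g (T v) := by
  let S : W →L⋆[ℂ] V →L[ℂ] ℂ := LinearMap.mkContinuous₂
    (LinearMap.mk₂'ₛₗ (starRingEnd ℂ) (RingHom.id ℂ) B hadd₁ hsmul₁ hadd₂ hsmul₂) K hK
  have hS : ∀ w v, S w v = B w v := fun _ _ => rfl
  let R : W →L[ℂ] V := ((InnerProductSpace.toDual ℂ V).symm.toContinuousLinearEquiv :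
    (V →L[ℂ] ℂ) →L⋆[ℂ] V).comp S
  have hR : ∀ w v, B w v = inner ℂ (R w) v := by
    intro w v
    rw [← hS]
    exact (InnerProductSpace.toDual_symm_apply (𝕜 := ℂ) (E := V)).symm
  have hT : ∀ w v, B w v = inner ℂ w (ContinuousLinearMap.adjoint R v) := by
    intro w v
    rw [ContinuousLinearMap.adjoint_inner_right, hR]
  refine ⟨ContinuousLinearMap.adjoint R, hT, fun g v => ?_⟩
  refine ext_inner_left ℂ fun w => ?_
  rw [← hT, inner_toHom_right, ← hT, ← hinv g (ρ.toHom g⁻¹ w), toHom_apply_inv_self]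

/-- A bounded invariant sesquilinear form on an irreducible representation is a multiple of the
inner product. -/
theorem IsIrreducible.form_eq_smul_inner {π : UnitaryRep G V} (hπ : π.IsIrreducible)
    (B : V → V → ℂ) (hadd₁ : ∀ w w' v, B (w + w') v = B w v + B w' v)
    (hsmul₁ : ∀ (c : ℂ) w v, B (c • w) v = conj c * B w v)
    (hadd₂ : ∀ w v v', B w (v + v') = B w v + B w v')
    (hsmul₂ : ∀ (c : ℂ) w v, B w (c • v) = c * B w v)
    (K : ℝ) (hK : ∀ w v, ‖B w v‖ ≤ K * ‖w‖ * ‖v‖)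
    (hinv : ∀ g w v, B (π.toHom g w) (π.toHom g v) = B w v) :
    ∃ c : ℂ, ∀ w v, B w v = c * inner ℂ w v := by
  obtain ⟨T, hT, hTπ⟩ := exists_intertwiner_of_form π π B hadd₁ hsmul₁ hadd₂ hsmul₂ K hK hinv
  obtain ⟨c, hc⟩ := hπ.exists_eq_smul T hTπ
  exact ⟨c, fun w v => by rw [hT, hc, inner_smul_right]⟩

/-- Two irreducible representations with a nonzero intertwining operator are equivalent. -/
theorem IsIrreducible.eq_zero_of_not_equivalent {π : UnitaryRep G V} {ρ : UnitaryRep G W}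
    (hπ : π.IsIrreducible) (hρ : ρ.IsIrreducible) (hne : ¬ π.Equivalent ρ) (T : V →L[ℂ] W)
    (hT : ∀ g v, T (π.toHom g v) = ρ.toHom g (T v)) : T = 0 := by
  by_contra hT0
  -- The pulled-back inner product is invariant, hence a multiple of the original one: T is a scaled
  -- isometry, and dividing by r = √c yields the equivalence.
  obtain ⟨c, hc⟩ := hπ.form_eq_smul_inner (fun w v => inner ℂ (T w) (T v))
    (by intros; simp) (by intros; simp [mul_comm]) (by intros; simp) (by intros; simp)
    (‖T‖ * ‖T‖) (fun w v => by
      calc _ ≤ ‖T w‖ * ‖T v‖ := norm_inner_le_norm _ _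
        _ ≤ (‖T‖ * ‖w‖) * (‖T‖ * ‖v‖) := by gcongr <;> exact T.le_opNorm _
        _ = _ := by ring)
    (fun g w v => by rw [hT, hT, LinearIsometryEquiv.inner_map_map])
  have hinj := (hπ.eq_zero_or_injective T hT).resolve_left hT0
  have := hπ.1
  obtain ⟨v₀, hv₀⟩ := exists_ne (0 : V)
  have hTv₀ : T v₀ ≠ 0 := fun h => hv₀ (hinj _ h)
  set r : ℝ := ‖T v₀‖ / ‖v₀‖ with hr
  have hr0 : 0 < r := div_pos (norm_pos_iff.2 hTv₀) (norm_pos_iff.2 hv₀)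
  have hcr : c = (r : ℂ) ^ 2 := by
    have h := hc v₀ v₀
    simp only [inner_self_eq_norm_sq_to_K] at h
    have h0 : (‖v₀‖ : ℂ) ≠ 0 := by exact_mod_cast norm_ne_zero_iff.2 hv₀
    rw [hr]; push_cast
    rw [div_pow, eq_div_iff (pow_ne_zero _ h0)]
    exact h.symm
  have hrC : (r : ℂ) ≠ 0 := by exact_mod_cast hr0.ne'
  let U₀ : V →ₗ[ℂ] W := (r : ℂ)⁻¹ • (T : V →ₗ[ℂ] W)
  have hU₀ : ∀ v, U₀ v = (r : ℂ)⁻¹ • T v := fun _ => rfl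
  let U : V →ₗᵢ[ℂ] W := U₀.isometryOfInner (fun v w => by
    rw [hU₀, hU₀, inner_smul_left, inner_smul_right, hc, hcr, map_inv₀, Complex.conj_ofReal]
    field_simp)
  have hUπ : ∀ g v, U (π.toHom g v) = ρ.toHom g (U v) := by
    intro g v
    change (r : ℂ)⁻¹ • T _ = ρ.toHom g ((r : ℂ)⁻¹ • T v)
    rw [hT, map_smul]
  -- An isometry from a complete space has closed range, so irreducibility of ρ applies to it.
  have hrange : LinearMap.range U.toLinearMap = ⊤ := by
    refine (hρ.2 (LinearMap.range U.toLinearMap) ?_ ?_).resolve_left ?_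
    · rw [LinearMap.coe_range]
      exact U.isometry.isClosedEmbedding.isClosed_range
    · rintro g _ ⟨v, rfl⟩
      exact ⟨π.toHom g v, hUπ g v⟩
    · intro h
      have : U v₀ ∈ LinearMap.range U.toLinearMap := ⟨v₀, rfl⟩
      rw [h, Submodule.mem_bot] at this
      exact hv₀ (U.injective (this.trans (map_zero U).symm))
  refine hne ⟨LinearIsometryEquiv.ofSurjective U (LinearMap.range_eq_top.1 hrange), hUπ⟩

end UnitaryRep

/-! ### Normalized integrals over compact sets. -/

/-- The normalized integral `μ(F)⁻¹ ∫_F f dμ`. -/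
def setMean {G : Type*} [MeasurableSpace G] (μ : Measure G) (F : Set G) (f : G → ℂ) : ℂ :=
  (μ.real F : ℂ)⁻¹ * ∫ g in F, f g ∂μ

section SetMean

variable {G : Type*} [TopologicalSpace G] [T2Space G] [MeasurableSpace G] [BorelSpace G]
  {μ : Measure G} [IsFiniteMeasureOnCompacts μ] {F : Set G}

theorem setMean_add (hF : IsCompact F) {f k : G → ℂ} (hf : Continuous f) (hk : Continuous k) :
    setMean μ F (fun g => f g + k g) = setMean μ F f + setMean μ F k := by
  simp only [setMean]
  rw [integral_add (hf.continuousOn.integrableOn_compact hF)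
    (hk.continuousOn.integrableOn_compact hF), mul_add]

theorem setMean_const_mul (c : ℂ) (f : G → ℂ) :
    setMean μ F (fun g => c * f g) = c * setMean μ F f := by
  simp only [setMean]
  rw [integral_const_mul]; ring

theorem setMean_finset_sum {ι : Type*} (s : Finset ι) (hF : IsCompact F) {f : ι → G → ℂ}
    (hf : ∀ i, Continuous (f i)) :
    setMean μ F (fun g => ∑ i ∈ s, f i g) = ∑ i ∈ s, setMean μ F (f i) := by
  simp only [setMean]
  rw [integral_finsetSum _ fun i _ => (hf i).continuousOn.integrableOn_compact hF,
    Finset.mul_sum]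

theorem measureReal_pos_of_isCompact (hF : IsCompact F) (hμ : 0 < μ F) : 0 < μ.real F :=
  ENNReal.toReal_pos hμ.ne' hF.measure_lt_top.ne

theorem norm_setMean_le (hF : IsCompact F) (hμ : 0 < μ F) {f : G → ℂ} {B : ℝ}
    (hB : ∀ g, ‖f g‖ ≤ B) : ‖setMean μ F f‖ ≤ B := by
  have h0 := measureReal_pos_of_isCompact hF hμ
  have h1 : ‖∫ g in F, f g ∂μ‖ ≤ B * μ.real F :=
    norm_setIntegral_le_of_norm_le_const hF.measure_lt_top fun g _ => hB g
  rw [setMean, norm_mul, norm_inv, Complex.norm_real, Real.norm_of_nonneg h0.le,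
    inv_mul_le_iff₀ h0]
  linarith

theorem setMean_const (hF : IsCompact F) (hμ : 0 < μ F) (c : ℂ) :
    setMean μ F (fun _ => c) = c := by
  have h0 := measureReal_pos_of_isCompact hF hμ
  have h1 : (μ.real F : ℂ) ≠ 0 := by exact_mod_cast h0.ne'
  rw [setMean, setIntegral_const, Complex.real_smul]
  field_simp

theorem norm_setIntegral_sub_le {A : Set G} (hF : IsCompact F) (hA : IsCompact A) {f : G → ℂ}
    (hf : Continuous f) {B : ℝ} (hB : ∀ g, ‖f g‖ ≤ B) :
    ‖(∫ g in A, f g ∂μ) - ∫ g in F, f g ∂μ‖ ≤ B * μ.real (A ∆ F) := by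
  have hm : MeasurableSet (A ∆ F) := hA.measurableSet.symmDiff hF.measurableSet
  have hlt : μ (A ∆ F) < ∞ := (measure_mono (by
    rw [Set.symmDiff_def]; exact Set.union_subset_union Set.sdiff_subset Set.sdiff_subset :
      A ∆ F ⊆ A ∪ F)).trans_lt (hA.union hF).measure_lt_top
  rw [← integral_indicator hA.measurableSet, ← integral_indicator hF.measurableSet,
    ← integral_sub ((integrable_indicator_iff hA.measurableSet).2
      (hf.continuousOn.integrableOn_compact hA))
      ((integrable_indicator_iff hF.measurableSet).2 (hf.continuousOn.integrableOn_compact hF))]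
  have : B * μ.real (A ∆ F) = ∫ g, (A ∆ F).indicator (fun _ => B) g ∂μ := by
    rw [integral_indicator hm, setIntegral_const, smul_eq_mul, mul_comm]
  rw [this]
  refine norm_integral_le_of_norm_le ?_ (Eventually.of_forall fun g => ?_)
  · exact (integrable_indicator_iff hm).2 (integrableOn_const hlt.ne)
  · by_cases h1 : g ∈ A <;> by_cases h2 : g ∈ F <;>
      simp [Set.mem_symmDiff, h1, h2, hB]

end SetMean

/-! ### Asymptotic two-sided invariance of Følner means. -/

section Folner

variable {G : Type*} [Group G] [TopologicalSpace G] [IsTopologicalGroup G]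
    [T2Space G] [MeasurableSpace G] [BorelSpace G]
    {μ : Measure G}

theorem IsGroupFolner.tendsto_symmDiff {F : ℕ → Set G} (hF : IsGroupFolner μ F) (g h : G) :
    Tendsto (fun n => μ (((fun x => g * x * h⁻¹) '' F n) ∆ F n) / μ (F n)) atTop (𝓝 0) := by
  refine tendsto_of_tendsto_of_tendsto_of_le_of_le tendsto_const_nhds
    (hF.2 {g, h} (Set.toFinite _).isCompact) (fun n => zero_le) (fun n => ?_)
  refine ENNReal.div_le_div_right ?_ _
  exact le_iSup₂_of_le g (by simp) (le_iSup₂_of_le h (by simp) le_rfl)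

variable [μ.IsHaarMeasure] [μ.IsMulRightInvariant]

theorem measurePreserving_mul_mul (g h : G) :
    MeasurePreserving (fun x => g * x * h) μ μ :=
  (measurePreserving_mul_right μ h).comp (measurePreserving_mul_left μ g)

theorem measurableEmbedding_mul_mul (g h : G) : MeasurableEmbedding (fun x : G => g * x * h) :=
  ((Homeomorph.mulLeft g).trans (Homeomorph.mulRight h)).measurableEmbedding

theorem IsGroupFolner.tendsto_setMean_sub {F : ℕ → Set G} (hF : IsGroupFolner μ F) {f : G → ℂ}
    (hf : Continuous f) {B : ℝ} (hB : ∀ g, ‖f g‖ ≤ B) (g h : G) :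
    Tendsto (fun n => setMean μ (F n) (fun x => f (g * x * h⁻¹)) - setMean μ (F n) f)
      atTop (𝓝 0) := by
  have h1 := (ENNReal.tendsto_toReal ENNReal.zero_ne_top).comp (hF.tendsto_symmDiff g h)
  have h2 := h1.const_mul B
  simp only [ENNReal.toReal_zero, mul_zero] at h2
  refine squeeze_zero_norm (fun n => ?_) h2
  obtain ⟨hc, hpos⟩ := hF.1 n
  have h0 := measureReal_pos_of_isCompact hc hpos
  have hcont : Continuous fun x : G => g * x * h⁻¹ := by fun_prop
  have hemb : MeasurableEmbedding fun x : G => g * x * h⁻¹ :=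
    measurableEmbedding_mul_mul g h⁻¹
  have e1 : ∫ x in F n, f (g * x * h⁻¹) ∂μ
      = ∫ x in (fun x => g * x * h⁻¹) '' F n, f x ∂μ :=
    ((measurePreserving_mul_mul g h⁻¹).setIntegral_image_emb hemb f (F n)).symm
  rw [setMean, setMean, ← mul_sub, e1, norm_mul, norm_inv, Complex.norm_real,
    Real.norm_of_nonneg h0.le, inv_mul_le_iff₀ h0]
  refine (norm_setIntegral_sub_le hc (hc.image hcont) hf hB).trans (le_of_eq ?_)
  simp only [Function.comp, ENNReal.toReal_div, Measure.real] at h0 ⊢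
  field_simp

end Folner

/-! ### Ultrafilter limits of coefficient means and Schur orthogonality. -/

theorem exists_tendsto_ultrafilter (U : Ultrafilter ℕ) {a : ℕ → ℂ} {B : ℝ}
    (h : ∀ n, ‖a n‖ ≤ B) : ∃ L, Tendsto a U (𝓝 L) := by
  obtain ⟨L, -, hL⟩ := (isCompact_closedBall (0 : ℂ) B).ultrafilter_le_nhds (U.map a)
    (by
      rw [Ultrafilter.coe_map, le_principal_iff, mem_map]
      exact univ_mem' fun n => by simpa using h n)
  exact ⟨L, hL⟩

namespace UnitaryRep

variable {G : Type*} [Group G] [TopologicalSpace G] [IsTopologicalGroup G]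
    [T2Space G] [MeasurableSpace G] [BorelSpace G]
    {μ : Measure G} [μ.IsHaarMeasure] [μ.IsMulRightInvariant]
variable {V : Type*} [NormedAddCommGroup V] [InnerProductSpace ℂ V] [CompleteSpace V]
variable {W : Type*} [NormedAddCommGroup W] [InnerProductSpace ℂ W] [CompleteSpace W]

@[fun_prop]
theorem continuous_coeff (π : UnitaryRep G V) (v w : V) : Continuous (π.coeff v w) :=
  continuous_const.inner (π.continuous_apply v)

theorem norm_coeff_le (π : UnitaryRep G V) (v w : V) (g : G) :
    ‖π.coeff v w g‖ ≤ ‖v‖ * ‖w‖ := by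
  rw [coeff, mul_comm]
  simpa using norm_inner_le_norm (𝕜 := ℂ) w (π.toHom g v)

/-- The product of a matrix coefficient and a conjugate matrix coefficient. -/
def coeffProd (π : UnitaryRep G V) (ρ : UnitaryRep G W) (v₁ v₂ : V) (w₁ w₂ : W) (g : G) : ℂ :=
  π.coeff v₁ v₂ g * conj (ρ.coeff w₁ w₂ g)

@[fun_prop]
theorem continuous_coeffProd (π : UnitaryRep G V) (ρ : UnitaryRep G W) (v₁ v₂ : V)
    (w₁ w₂ : W) : Continuous (coeffProd π ρ v₁ v₂ w₁ w₂) :=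
  (π.continuous_coeff v₁ v₂).mul (Complex.continuous_conj.comp (ρ.continuous_coeff w₁ w₂))

theorem norm_coeffProd_le (π : UnitaryRep G V) (ρ : UnitaryRep G W) (v₁ v₂ : V)
    (w₁ w₂ : W) (g : G) :
    ‖coeffProd π ρ v₁ v₂ w₁ w₂ g‖ ≤ ‖v₁‖ * ‖v₂‖ * (‖w₁‖ * ‖w₂‖) := by
  rw [coeffProd, norm_mul, RCLike.norm_conj]
  gcongr
  · exact π.norm_coeff_le _ _ _
  · exact ρ.norm_coeff_le _ _ _

theorem coeffProd_self (π : UnitaryRep G V) (v w : V) (g : G) :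
    coeffProd π π v w v w g = ((‖π.coeff v w g‖ ^ 2 : ℝ) : ℂ) := by
  rw [coeffProd, Complex.mul_conj, Complex.normSq_eq_norm_sq]

/-- Limits along an ultrafilter of means over a Følner sequence of products of matrix
coefficients: they form a bounded form, sesquilinear in either pair of variables, and invariant
under the representations. -/
theorem exists_limit_form (π : UnitaryRep G V) (ρ : UnitaryRep G W) {F : ℕ → Set G}
    (hF : IsGroupFolner μ F) (U : Ultrafilter ℕ) (hU : (U : Filter ℕ) ≤ atTop) :
    ∃ Φ : V → V → W → W → ℂ,
      (∀ v₁ v₂ w₁ w₂, Tendsto (fun n => setMean μ (F n) (coeffProd π ρ v₁ v₂ w₁ w₂)) U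
        (𝓝 (Φ v₁ v₂ w₁ w₂))) ∧
      (∀ v₁ v₂ w₁ w₂, ‖Φ v₁ v₂ w₁ w₂‖ ≤ ‖v₁‖ * ‖v₂‖ * (‖w₁‖ * ‖w₂‖)) ∧
      (∀ v₁ v₁' v₂ w₁ w₂, Φ (v₁ + v₁') v₂ w₁ w₂ = Φ v₁ v₂ w₁ w₂ + Φ v₁' v₂ w₁ w₂) ∧
      (∀ v₁ v₂ v₂' w₁ w₂, Φ v₁ (v₂ + v₂') w₁ w₂ = Φ v₁ v₂ w₁ w₂ + Φ v₁ v₂' w₁ w₂) ∧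
      (∀ v₁ v₂ w₁ w₁' w₂, Φ v₁ v₂ (w₁ + w₁') w₂ = Φ v₁ v₂ w₁ w₂ + Φ v₁ v₂ w₁' w₂) ∧
      (∀ v₁ v₂ w₁ w₂ w₂', Φ v₁ v₂ w₁ (w₂ + w₂') = Φ v₁ v₂ w₁ w₂ + Φ v₁ v₂ w₁ w₂') ∧
      (∀ (c : ℂ) v₁ v₂ w₁ w₂, Φ (c • v₁) v₂ w₁ w₂ = c * Φ v₁ v₂ w₁ w₂) ∧
      (∀ (c : ℂ) v₁ v₂ w₁ w₂, Φ v₁ (c • v₂) w₁ w₂ = conj c * Φ v₁ v₂ w₁ w₂) ∧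
      (∀ (c : ℂ) v₁ v₂ w₁ w₂, Φ v₁ v₂ (c • w₁) w₂ = conj c * Φ v₁ v₂ w₁ w₂) ∧
      (∀ (c : ℂ) v₁ v₂ w₁ w₂, Φ v₁ v₂ w₁ (c • w₂) = c * Φ v₁ v₂ w₁ w₂) ∧
      (∀ g v₁ v₂ w₁ w₂, Φ (π.toHom g v₁) v₂ (ρ.toHom g w₁) w₂ = Φ v₁ v₂ w₁ w₂) ∧
      (∀ g v₁ v₂ w₁ w₂, Φ v₁ (π.toHom g v₂) w₁ (ρ.toHom g w₂) = Φ v₁ v₂ w₁ w₂) := by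
  have hb : ∀ v₁ v₂ w₁ w₂ n, ‖setMean μ (F n) (coeffProd π ρ v₁ v₂ w₁ w₂)‖
      ≤ ‖v₁‖ * ‖v₂‖ * (‖w₁‖ * ‖w₂‖) := fun v₁ v₂ w₁ w₂ n =>
    norm_setMean_le (hF.1 n).1 (hF.1 n).2 (norm_coeffProd_le π ρ v₁ v₂ w₁ w₂)
  have hex : ∀ v₁ v₂ w₁ w₂, ∃ L,
      Tendsto (fun n => setMean μ (F n) (coeffProd π ρ v₁ v₂ w₁ w₂)) U (𝓝 L) :=
    fun v₁ v₂ w₁ w₂ => exists_tendsto_ultrafilter U (hb v₁ v₂ w₁ w₂)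
  choose Φ hΦ using hex
  have hadd : ∀ a₁ a₂ b₁ b₂ a₁' a₂' b₁' b₂' c₁ c₂ d₁ d₂,
      (∀ g, coeffProd π ρ a₁ a₂ b₁ b₂ g
        = coeffProd π ρ a₁' a₂' b₁' b₂' g + coeffProd π ρ c₁ c₂ d₁ d₂ g) →
      Φ a₁ a₂ b₁ b₂ = Φ a₁' a₂' b₁' b₂' + Φ c₁ c₂ d₁ d₂ := by
    intro a₁ a₂ b₁ b₂ a₁' a₂' b₁' b₂' c₁ c₂ d₁ d₂ h
    refine tendsto_nhds_unique (hΦ a₁ a₂ b₁ b₂) ?_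
    refine ((hΦ a₁' a₂' b₁' b₂').add (hΦ c₁ c₂ d₁ d₂)).congr fun n => ?_
    rw [← setMean_add (hF.1 n).1 (by fun_prop) (by fun_prop)]
    congr 1; funext g; exact (h g).symm
  have hsmul : ∀ a₁ a₂ b₁ b₂ a₁' a₂' b₁' b₂' (c : ℂ),
      (∀ g, coeffProd π ρ a₁ a₂ b₁ b₂ g = c * coeffProd π ρ a₁' a₂' b₁' b₂' g) →
      Φ a₁ a₂ b₁ b₂ = c * Φ a₁' a₂' b₁' b₂' := by
    intro a₁ a₂ b₁ b₂ a₁' a₂' b₁' b₂' c h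
    refine tendsto_nhds_unique (hΦ a₁ a₂ b₁ b₂) ?_
    refine ((hΦ a₁' a₂' b₁' b₂').const_mul c).congr fun n => ?_
    rw [← setMean_const_mul]
    congr 1; funext g; exact (h g).symm
  have hinv : ∀ (g h : G) a₁ a₂ b₁ b₂ a₁' a₂' b₁' b₂',
      (∀ x, coeffProd π ρ a₁ a₂ b₁ b₂ x = coeffProd π ρ a₁' a₂' b₁' b₂' (g * x * h⁻¹)) →
      Φ a₁ a₂ b₁ b₂ = Φ a₁' a₂' b₁' b₂' := by
    intro g h a₁ a₂ b₁ b₂ a₁' a₂' b₁' b₂' hq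
    rw [← sub_eq_zero]
    refine tendsto_nhds_unique ((hΦ a₁ a₂ b₁ b₂).sub (hΦ a₁' a₂' b₁' b₂')) ?_
    have := (hF.tendsto_setMean_sub (continuous_coeffProd π ρ a₁' a₂' b₁' b₂')
      (norm_coeffProd_le π ρ a₁' a₂' b₁' b₂') g h).mono_left hU
    refine this.congr fun n => ?_
    congr 2; funext x; exact (hq x).symm
  refine ⟨Φ, hΦ, fun v₁ v₂ w₁ w₂ => le_of_tendsto (hΦ v₁ v₂ w₁ w₂).norm
    (Eventually.of_forall (hb v₁ v₂ w₁ w₂)), ?_, ?_, ?_, ?_, ?_, ?_, ?_, ?_, ?_, ?_⟩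
  · intros; apply hadd; intro g; simp [coeffProd, coeff]; ring
  · intros; apply hadd; intro g; simp [coeffProd, coeff]; ring
  · intros; apply hadd; intro g; simp [coeffProd, coeff]; ring
  · intros; apply hadd; intro g; simp [coeffProd, coeff]; ring
  · intros; apply hsmul; intro g; simp [coeffProd, coeff]; ring
  · intros; apply hsmul; intro g; simp [coeffProd, coeff]; ring
  · intros; apply hsmul; intro g; simp [coeffProd, coeff]; ring
  · intros; apply hsmul; intro g; simp [coeffProd, coeff]; ring
  · intro g v₁ v₂ w₁ w₂
    -- Moving v₁ and w₁ by g is the right translation x ↦ xg of the coefficients; moving v₂ and w₂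
    -- is the left translation x ↦ g⁻¹x.
    apply hinv 1 g⁻¹
    intro x
    simp [coeffProd, coeff]
  · intro g v₁ v₂ w₁ w₂
    apply hinv g⁻¹ 1
    intro x
    simp only [coeffProd, coeff, inv_one, mul_one, toHom_mul_apply, inner_toHom_left]

theorem IsIrreducible.exists_tendsto_ultrafilter {π : UnitaryRep G V} (hπ : π.IsIrreducible)
    {F : ℕ → Set G} (hF : IsGroupFolner μ F) (U : Ultrafilter ℕ) (hU : (U : Filter ℕ) ≤ atTop) :
    ∃ c : ℂ, ∀ v₁ v₂ w₁ w₂,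
      Tendsto (fun n => setMean μ (F n) (coeffProd π π v₁ v₂ w₁ w₂)) U
        (𝓝 (c * (inner ℂ w₁ v₁ * inner ℂ v₂ w₂))) := by
  obtain ⟨Φ, hΦ, hb, ha₁, ha₂, ha₃, ha₄, hs₁, hs₂, hs₃, hs₄, hi₁, hi₂⟩ :=
    exists_limit_form π π hF U hU
  -- Schur's lemma is used twice: first in (w₁, v₁) with the other pair frozen, then in (v₂, w₂) to
  -- identify the resulting scalar, which is read off at a unit vector v.
  have h1 : ∀ v₂ w₂, ∃ c : ℂ, ∀ w₁ v₁, Φ v₁ v₂ w₁ w₂ = c * inner ℂ w₁ v₁ := fun v₂ w₂ =>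
    hπ.form_eq_smul_inner (fun w₁ v₁ => Φ v₁ v₂ w₁ w₂) (fun _ _ _ => ha₃ _ _ _ _ _)
      (fun _ _ _ => hs₃ _ _ _ _ _) (fun _ _ _ => ha₁ _ _ _ _ _) (fun _ _ _ => hs₁ _ _ _ _ _)
      (‖v₂‖ * ‖w₂‖) (fun w₁ v₁ => (hb _ _ _ _).trans (le_of_eq (by ring)))
      (fun _ _ _ => hi₁ _ _ _ _ _)
  choose c₁ hc₁ using h1
  have := hπ.1
  obtain ⟨v, hv⟩ := exists_norm_eq V (zero_le_one (α := ℝ))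
  obtain ⟨c, hc⟩ := hπ.form_eq_smul_inner (fun v₂ w₂ => Φ v v₂ v w₂) (fun _ _ _ => ha₂ _ _ _ _ _)
      (fun _ _ _ => hs₂ _ _ _ _ _) (fun _ _ _ => ha₄ _ _ _ _ _) (fun _ _ _ => hs₄ _ _ _ _ _)
      1 (fun v₂ w₂ => (hb _ _ _ _).trans (le_of_eq (by rw [hv]; ring)))
      (fun _ _ _ => hi₂ _ _ _ _ _)
  refine ⟨c, fun v₁ v₂ w₁ w₂ => ?_⟩
  have e : c₁ v₂ w₂ = c * inner ℂ v₂ w₂ := by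
    have := hc₁ v₂ w₂ v v
    rw [hc v₂ w₂, inner_self_eq_norm_sq_to_K, hv] at this
    simpa using this.symm
  have := hΦ v₁ v₂ w₁ w₂
  rw [hc₁, e] at this
  convert this using 2
  ring

/-- Means of products of coefficients of inequivalent representations tend to zero. -/
theorem IsIrreducible.tendsto_setMean_of_not_equivalent {π : UnitaryRep G V}
    {ρ : UnitaryRep G W} (hπ : π.IsIrreducible) (hρ : ρ.IsIrreducible)
    (hne : ¬ π.Equivalent ρ) {F : ℕ → Set G} (hF : IsGroupFolner μ F) (v₁ v₂ : V) (w₁ w₂ : W) :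
    Tendsto (fun n => setMean μ (F n) (coeffProd π ρ v₁ v₂ w₁ w₂)) atTop (𝓝 0) := by
  refine (tendsto_iff_ultrafilter _ _ _).2 fun U hU => ?_
  obtain ⟨Φ, hΦ, hb, ha₁, ha₂, ha₃, ha₄, hs₁, hs₂, hs₃, hs₄, hi₁, hi₂⟩ :=
    exists_limit_form π ρ hF U hU
  obtain ⟨T, hT, hTπ⟩ := exists_intertwiner_of_form π ρ (fun w₁ v₁ => Φ v₁ v₂ w₁ w₂)
      (fun _ _ _ => ha₃ _ _ _ _ _)
      (fun _ _ _ => hs₃ _ _ _ _ _) (fun _ _ _ => ha₁ _ _ _ _ _) (fun _ _ _ => hs₁ _ _ _ _ _)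
      (‖v₂‖ * ‖w₂‖) (fun w₁ v₁ => (hb _ _ _ _).trans (le_of_eq (by ring)))
      (fun _ _ _ => hi₁ _ _ _ _ _)
  have h0 := hπ.eq_zero_of_not_equivalent hρ hne T hTπ
  have := hΦ v₁ v₂ w₁ w₂
  rwa [hT w₁ v₁, h0, zero_apply, inner_zero_right] at this

/-- Schur orthogonality over a Følner sequence for finite-dimensional representations. -/
theorem IsIrreducible.tendsto_setMean [FiniteDimensional ℂ V] {π : UnitaryRep G V}
    (hπ : π.IsIrreducible) {F : ℕ → Set G} (hF : IsGroupFolner μ F) (v₁ v₂ w₁ w₂ : V) :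
    Tendsto (fun n => setMean μ (F n) (coeffProd π π v₁ v₂ w₁ w₂)) atTop
      (𝓝 ((Module.finrank ℂ V : ℂ)⁻¹ * (inner ℂ w₁ v₁ * inner ℂ v₂ w₂))) := by
  refine (tendsto_iff_ultrafilter _ _ _).2 fun U hU => ?_
  obtain ⟨c, hc⟩ := hπ.exists_tendsto_ultrafilter hF U hU
  suffices h : c = (Module.finrank ℂ V : ℂ)⁻¹ by rw [← h]; exact hc v₁ v₂ w₁ w₂
  have := hπ.1
  obtain ⟨v, hv⟩ := exists_norm_eq V (zero_le_one (α := ℝ))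
  let e := stdOrthonormalBasis ℂ V
  -- By Parseval the sum of means is 1 for every n, while its limit is c times the dimension.
  have h1 : Tendsto (fun n => ∑ i, setMean μ (F n) (coeffProd π π v (e i) v (e i))) U
      (𝓝 (∑ i, c * (inner ℂ v v * inner ℂ (e i) (e i)))) :=
    tendsto_finsetSum _ fun i _ => hc v (e i) v (e i)
  have h2 : ∀ n, ∑ i, setMean μ (F n) (coeffProd π π v (e i) v (e i)) = 1 := by
    intro n
    rw [← setMean_finset_sum _ (hF.1 n).1 (fun i => by fun_prop)]
    rw [← setMean_const (hF.1 n).1 (hF.1 n).2 (μ := μ) 1]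
    congr 1
    funext g
    simp_rw [coeffProd_self, coeff]
    rw [← Complex.ofReal_sum, e.sum_sq_norm_inner_right]
    simp [hv]
  simp_rw [h2] at h1
  have h4 := tendsto_nhds_unique h1 tendsto_const_nhds
  simp only [inner_self_eq_norm_sq_to_K, hv, OrthonormalBasis.norm_eq_one] at h4
  simp only [RCLike.ofReal_one, one_pow, mul_one, Finset.sum_const, Finset.card_univ,
    Fintype.card_fin, nsmul_eq_mul] at h4
  exact eq_inv_of_mul_eq_one_right h4

theorem setMean_coeffProd_self (π : UnitaryRep G V) (S : Set G) (v w : V) :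
    setMean μ S (coeffProd π π v w v w) = ((π.energy μ S v w / μ S).toReal : ℂ) := by
  simp only [setMean, coeffProd_self]
  rw [integral_complex_ofReal, integral_eq_lintegral_of_nonneg_ae (Eventually.of_forall fun g => by
    positivity) (by fun_prop), ENNReal.toReal_div, Complex.ofReal_div, div_eq_inv_mul, energy]
  congr 4
  funext g
  rw [ENNReal.ofReal_pow (norm_nonneg _), ofReal_norm]

theorem energy_le (π : UnitaryRep G V) (S : Set G) (v w : V) :
    π.energy μ S v w ≤ ENNReal.ofReal ((‖v‖ * ‖w‖) ^ 2) * μ S := by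
  rw [energy, ← setLIntegral_const]
  refine lintegral_mono fun g => ?_
  rw [← ofReal_norm, ← ENNReal.ofReal_pow (norm_nonneg _)]
  refine ENNReal.ofReal_le_ofReal ?_
  gcongr
  exact π.norm_coeff_le v w g

theorem energy_div_le (π : UnitaryRep G V) (S : Set G) (v w : V) :
    π.energy μ S v w / μ S ≤ ENNReal.ofReal ((‖v‖ * ‖w‖) ^ 2) :=
  ENNReal.div_le_of_le_mul (π.energy_le S v w)

/-- An irreducible representation with one diagonal matrix coefficient of positive lower mean
square over a Følner sequence is finite-dimensional. -/
theorem IsIrreducible.finiteDimensional_of_liminf_pos {π : UnitaryRep G V}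
    (hπ : π.IsIrreducible) {F : ℕ → Set G} (hF : IsGroupFolner μ F) (v : V)
    (h : 0 < liminf (fun n => π.energy μ (F n) v v / μ (F n)) atTop) :
    FiniteDimensional ℂ V := by
  obtain ⟨δ, hδ0, hδ⟩ := exists_between h
  have hδ' := eventually_lt_of_lt_liminf hδ
  let U : Ultrafilter ℕ := Ultrafilter.of atTop
  have hU : (U : Filter ℕ) ≤ atTop := Ultrafilter.of_le atTop
  obtain ⟨c, hc⟩ := hπ.exists_tendsto_ultrafilter hF U hU
  have hre : ∀ v w : V, Tendsto (fun n => (π.energy μ (F n) v w / μ (F n)).toReal) U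
      (𝓝 (c.re * (‖v‖ ^ 2 * ‖w‖ ^ 2))) := by
    intro v w
    have := (Complex.continuous_re.tendsto _).comp (hc v w v w)
    simp only [Function.comp_def, setMean_coeffProd_self π, Complex.ofReal_re,
      inner_self_eq_norm_sq_to_K] at this
    convert this using 2
    simp [← Complex.ofReal_pow, ← Complex.ofReal_mul]
  have hδt : δ ≠ ∞ := hδ.ne_top
  -- The bound δ holds eventually along `atTop`, hence along `U`, and survives in the limit.
  have hpos : 0 < c.re * (‖v‖ ^ 2 * ‖v‖ ^ 2) := by
    refine (ENNReal.toReal_pos hδ0.ne' hδt).trans_le ?_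
    refine ge_of_tendsto (hre v v) ?_
    filter_upwards [hU hδ'] with n hn
    exact ENNReal.toReal_mono ((energy_div_le π _ v v).trans_lt ENNReal.ofReal_lt_top).ne hn.le
  have hcpos : 0 < c.re := pos_of_mul_pos_left hpos (by positivity)
  have := hπ.1
  obtain ⟨x, hx⟩ := exists_norm_eq V (zero_le_one (α := ℝ))
  -- Every orthonormal vector contributes Re c to the limit of a sum that Bessel bounds by 1, so
  -- orthonormal families have at most 1 / Re c members.
  have hbessel : ∀ {w : Set V} (e : w → V), Orthonormal ℂ e → ∀ s : Finset w,
      s.card * c.re ≤ 1 := by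
    intro w e he s
    have hn : ∀ i, ‖e i‖ = 1 := he.1
    have h1 : Tendsto (fun n => ∑ i ∈ s, setMean μ (F n) (coeffProd π π x (e i) x (e i))) U
        (𝓝 (∑ i ∈ s, c * (inner ℂ x x * inner ℂ (e i) (e i)))) :=
      tendsto_finsetSum _ fun i _ => hc x (e i) x (e i)
    have h2 : ∀ n, ‖∑ i ∈ s, setMean μ (F n) (coeffProd π π x (e i) x (e i))‖ ≤ 1 := by
      intro n
      rw [← setMean_finset_sum _ (hF.1 n).1 (fun i => by fun_prop)]
      refine norm_setMean_le (hF.1 n).1 (hF.1 n).2 fun g => ?_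
      simp_rw [coeffProd_self, coeff]
      rw [← Complex.ofReal_sum, Complex.norm_real, Real.norm_of_nonneg (by positivity)]
      refine (he.sum_inner_products_le _).trans ?_
      simp [hx]
    have h4 := le_of_tendsto h1.norm (Eventually.of_forall h2)
    simp only [inner_self_eq_norm_sq_to_K, hx] at h4
    refine le_trans ?_ h4
    refine le_trans (le_of_eq ?_) (Complex.re_le_norm _)
    simp [hn]
  obtain ⟨w, b, hb⟩ := exists_hilbertBasis ℂ V
  have hfin : w.Finite := by
    by_contra hinf
    obtain ⟨N, hN⟩ := exists_nat_gt (1 / c.re)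
    have : Infinite w := Set.infinite_coe_iff.2 hinf
    obtain ⟨s, hs⟩ := Infinite.exists_subset_card_eq w N
    have h5 := hbessel b b.orthonormal s
    rw [hs] at h5
    rw [div_lt_iff₀ hcpos] at hN
    linarith
  have : Fintype w := hfin.fintype
  exact Module.Basis.finiteDimensional_of_finite b.toOrthonormalBasis.toBasis

end UnitaryRep

/-! ### Temperedness and the flip operator in finite dimension. -/

theorem inner_smul_setIntegral_apply {G : Type*} [TopologicalSpace G] [T2Space G]
    [MeasurableSpace G] [BorelSpace G] {μ : Measure G} [IsFiniteMeasureOnCompacts μ]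
    {E : Type*} [NormedAddCommGroup E] [InnerProductSpace ℂ E] [CompleteSpace E] {S : Set G}
    (hS : IsCompact S) {f : G → E →L[ℂ] E} (hf : Continuous f) (x y : E) :
    inner ℂ y (((μ.real S : ℂ)⁻¹ • ∫ g in S, f g ∂μ) x)
      = setMean μ S (fun g => inner ℂ y (f g x)) := by
  have hint : IntegrableOn f S μ := hf.continuousOn.integrableOn_compact hS
  rw [smul_apply, ContinuousLinearMap.integral_apply hint, inner_smul_right, setMean,
    integral_inner (hint.apply_continuousLinearMap x)]

namespace UnitaryRep

variable {G : Type*} [Group G] [TopologicalSpace G] [IsTopologicalGroup G]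
    [T2Space G] [MeasurableSpace G] [BorelSpace G]
    {μ : Measure G} [μ.IsHaarMeasure] [μ.IsMulRightInvariant]
variable {V : Type*} [NormedAddCommGroup V] [InnerProductSpace ℂ V] [CompleteSpace V]

theorem IsIrreducible.tendsto_energy_div [FiniteDimensional ℂ V] {π : UnitaryRep G V}
    (hπ : π.IsIrreducible) {F : ℕ → Set G} (hF : IsGroupFolner μ F) (v w : V) :
    Tendsto (fun n => π.energy μ (F n) v w / μ (F n)) atTop
      (𝓝 (ENNReal.ofReal ((Module.finrank ℂ V : ℝ)⁻¹ * (‖v‖ ^ 2 * ‖w‖ ^ 2)))) := by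
  have h := (Complex.continuous_re.tendsto _).comp (hπ.tendsto_setMean hF v w v w)
  simp only [Function.comp_def, setMean_coeffProd_self, Complex.ofReal_re,
    inner_self_eq_norm_sq_to_K] at h
  rw [← ENNReal.tendsto_toReal_iff
    (fun n => ((energy_div_le π _ v w).trans_lt ENNReal.ofReal_lt_top).ne) ENNReal.ofReal_ne_top,
    ENNReal.toReal_ofReal (by positivity)]
  convert h using 2
  simp [← Complex.ofReal_pow, ← Complex.ofReal_mul, ← Complex.ofReal_natCast, ← Complex.ofReal_inv]

theorem IsIrreducible.asympEquiv_energy [FiniteDimensional ℂ V] {π : UnitaryRep G V}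
    (hπ : π.IsIrreducible) {F : ℕ → Set G} (hF : IsGroupFolner μ F) {v w : V}
    (hv : v ≠ 0) (hw : w ≠ 0) :
    AsympEquiv (fun n => π.energy μ (F n) v w) (fun n => μ (F n)) := by
  have h := hπ.tendsto_energy_div hF v w
  have := hπ.1
  have hd : 0 < (Module.finrank ℂ V : ℝ) := by exact_mod_cast Module.finrank_pos
  have hv' := norm_pos_iff.2 hv
  have hw' := norm_pos_iff.2 hw
  rw [AsympEquiv, h.liminf_eq, h.limsup_eq]
  exact ⟨ENNReal.ofReal_pos.2 (by positivity), ENNReal.ofReal_lt_top⟩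

/-- Divided by μ(Fₙ), the reference energy has a positive finite limit, so it may be replaced by
μ(Fₙ). Coefficients are bounded, hence the energy of a symmetric difference is at most a constant
times its measure, and the Følner condition finishes. -/
theorem IsIrreducible.isCTempered [FiniteDimensional ℂ V] {π : UnitaryRep G V}
    (hπ : π.IsIrreducible) {F : ℕ → Set G} (hF : IsGroupFolner μ F)
    (h1 : ∀ n, F n ∈ 𝓝 (1 : G)) : π.IsCTempered μ F := by
  refine ⟨fun n => ⟨(hF.1 n).1.measurableSet, ?_, h1 n⟩, ?_⟩
  · rw [(hF.1 n).1.isClosed.closure_eq]; exact (hF.1 n).1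
  have := hπ.1
  have hd : 0 < (Module.finrank ℂ V : ℝ) := by exact_mod_cast Module.finrank_pos
  obtain ⟨v₀, hv₀⟩ := exists_norm_eq V (zero_le_one (α := ℝ))
  have h0 := hπ.tendsto_energy_div hF v₀ v₀
  rw [hv₀] at h0
  set L : ℝ≥0∞ := ENNReal.ofReal ((Module.finrank ℂ V : ℝ)⁻¹ * (1 ^ 2 * 1 ^ 2)) with hL
  have hL0 : L ≠ 0 := (ENNReal.ofReal_pos.2 (by positivity)).ne'
  have hdiv : ∀ (a : ℕ → ℝ≥0∞) n, a n / π.energy μ (F n) v₀ v₀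
      = (a n / μ (F n)) / (π.energy μ (F n) v₀ v₀ / μ (F n)) := by
    intro a n
    have hp := (hF.1 n).2.ne'
    have ht := (hF.1 n).1.measure_lt_top (μ := μ).ne
    rw [div_eq_mul_inv (a n), div_eq_mul_inv (π.energy μ (F n) v₀ v₀)]
    exact (ENNReal.mul_div_mul_right _ _ (ENNReal.inv_ne_zero.2 ht) (ENNReal.inv_ne_top.2 hp)).symm
  refine ⟨v₀, hv₀, fun v₁ v₂ => ?_, fun v₁ v₂ C hC => ?_⟩
  · have h2 := ENNReal.Tendsto.div (hπ.tendsto_energy_div hF v₁ v₂) (Or.inr hL0) h0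
      (Or.inl ENNReal.ofReal_ne_top)
    simp_rw [hdiv (fun n => π.energy μ (F n) v₁ v₂)]
    rw [h2.limsup_eq]
    exact ENNReal.div_lt_top ENNReal.ofReal_ne_top hL0
  · set B : ℝ≥0∞ := ENNReal.ofReal ((‖v₁‖ * ‖v₂‖) ^ 2) with hB
    -- Temperedness translates by g₂⁻¹ · g₁ and the Følner condition by g · h⁻¹, so the latter is
    -- needed on C⁻¹.
    have h3 := ENNReal.Tendsto.const_mul (a := B) (hF.2 C⁻¹ hC.inv)
      (Or.inr ENNReal.ofReal_ne_top)
    have h4 := ENNReal.Tendsto.div h3 (Or.inr hL0) h0 (Or.inl ENNReal.ofReal_ne_top)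
    simp only [mul_zero, ENNReal.zero_div] at h4
    refine tendsto_of_tendsto_of_tendsto_of_le_of_le tendsto_const_nhds h4
      (fun n => zero_le) (fun n => ?_)
    dsimp only
    rw [hdiv (fun n => ⨆ g₁ ∈ C, ⨆ g₂ ∈ C,
          π.energy μ (((fun x => g₂⁻¹ * x * g₁) '' F n) ∆ F n) v₁ v₂), ← mul_div_assoc]
    gcongr
    refine iSup₂_le fun g₁ hg₁ => iSup₂_le fun g₂ hg₂ => ?_
    refine (π.energy_le _ v₁ v₂).trans ?_
    gcongr
    refine le_iSup₂_of_le g₂⁻¹ (by simpa using hg₂)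
      (le_iSup₂_of_le g₁⁻¹ (by simpa using hg₁) ?_)
    rw [inv_inv]

theorem braidTwist_tmul (π : UnitaryRep G V) (g : G) (a b : V) :
    π.braidTwist g (a ⊗ₜ b) = π.toHom g⁻¹ a ⊗ₜ π.toHom g b := rfl

theorem continuous_braidTwist [FiniteDimensional ℂ V] (π : UnitaryRep G V) :
    Continuous π.braidTwist := by
  refine continuous_clm_apply.2 fun x => ?_
  induction x with
  | zero => simpa using continuous_const
  | add x y hx hy => simp only [map_add]; exact hx.add hy
  | tmul a b =>
    let m : V →L[ℂ] V →L[ℂ] V ⊗[ℂ] V := (TensorProduct.mk ℂ V V).mkContinuous₂ 1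
      (fun a b => by simp [TensorProduct.norm_tmul])
    have : (fun g => π.braidTwist g (a ⊗ₜ b)) = fun g => m (π.toHom g⁻¹ a) (π.toHom g b) := rfl
    rw [this]
    exact (m.continuous.comp ((π.continuous_apply a).comp continuous_inv)).clm_apply
      (π.continuous_apply b)

/-- Between pure tensors the coefficient of π(g⁻¹) ⊗ π(g) is a product of one coefficient of π and
one conjugate coefficient, so this is Schur orthogonality; bilinearity handles all tensors. -/
theorem IsIrreducible.tendsto_braidTwist [FiniteDimensional ℂ V] {π : UnitaryRep G V}
    (hπ : π.IsIrreducible) {F : ℕ → Set G} (hF : IsGroupFolner μ F) :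
    Tendsto (fun n => ContinuousLinearMapWOT.ofCLM
        (((μ.real (F n) : ℂ))⁻¹ • ∫ g in F n, π.braidTwist g ∂μ)) atTop
      (𝓝 (ContinuousLinearMapWOT.ofCLM ((Module.finrank ℂ V : ℂ)⁻¹ • braiding V))) := by
  have : CompleteSpace (V ⊗[ℂ] V) := FiniteDimensional.complete ℂ _
  rw [ContinuousLinearMapWOT.tendsto_iff_forall_inner_apply_tendsto]
  intro x y
  have key : ∀ n, inner ℂ y ((((μ.real (F n) : ℂ))⁻¹ • ∫ g in F n, π.braidTwist g ∂μ) x)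
      = setMean μ (F n) (fun g => inner ℂ y (π.braidTwist g x)) := fun n =>
    inner_smul_setIntegral_apply (hF.1 n).1 π.continuous_braidTwist x y
  change Tendsto (fun n => inner ℂ y ((((μ.real (F n) : ℂ))⁻¹ •
    ∫ g in F n, π.braidTwist g ∂μ) x)) atTop
      (𝓝 (inner ℂ y (((Module.finrank ℂ V : ℂ)⁻¹ • braiding V) x)))
  simp_rw [key]
  clear key
  have hc : ∀ x y, Continuous fun g => inner ℂ y (π.braidTwist g x) := fun x y =>
    continuous_const.inner (π.continuous_braidTwist.clm_apply continuous_const)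
  induction x with
  | zero => simp [setMean]
  | add x₁ x₂ h₁ h₂ =>
    simp only [map_add, inner_add_right]
    refine (h₁.add h₂).congr fun n => ?_
    rw [setMean_add (hF.1 n).1 (hc _ _) (hc _ _)]
  | tmul v w =>
    induction y with
    | zero => simp [setMean]
    | add y₁ y₂ h₁ h₂ =>
      simp only [inner_add_left]
      refine (h₁.add h₂).congr fun n => ?_
      rw [setMean_add (hF.1 n).1 (hc _ _) (hc _ _)]
    | tmul a b =>
      have h := hπ.tendsto_setMean hF w b a v
      have e : ∀ g, inner ℂ (a ⊗ₜ[ℂ] b) (π.braidTwist g (v ⊗ₜ w)) = coeffProd π π w b a v g := by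
        intro g
        rw [braidTwist_tmul, TensorProduct.inner_tmul, coeffProd, coeff, coeff, inner_conj_symm,
          inner_toHom_left, mul_comm]
      simp_rw [e]
      convert h using 2
      rw [smul_apply, inner_smul_right]
      congr 1

end UnitaryRep

/-! ### Translations on L¹ and passing from right to left invariance. -/

section Translation

open scoped Pointwise

variable {G : Type*} [Group G] [TopologicalSpace G] [IsTopologicalGroup G]
    [T2Space G] [LocallyCompactSpace G] [SecondCountableTopology G]
    [MeasurableSpace G] [BorelSpace G]
    {μ : Measure G} [μ.IsHaarMeasure] [μ.IsMulRightInvariant]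

/-- A bi-invariant Haar measure is invariant under inversion. -/
theorem isInvInvariant_of_isMulRightInvariant : μ.IsInvInvariant := by
  constructor
  -- Inversion multiplies μ by a scalar c; inverting twice forces c² = 1.
  let c : ℝ≥0∞ := Measure.haarScalarFactor μ.inv μ
  have hc : μ.inv = c • μ := Measure.isMulLeftInvariant_eq_smul_of_regular μ.inv μ
  have h1 : μ = c ^ 2 • μ := by
    calc μ = μ.inv.inv := (Measure.inv_inv μ).symm
      _ = c • μ.inv := by rw [hc, Measure.inv, Measure.map_smul, ← Measure.inv_def μ, hc]
      _ = c ^ 2 • μ := by rw [hc, smul_smul, pow_two]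
  obtain ⟨K⟩ : Nonempty (TopologicalSpace.PositiveCompacts G) := inferInstance
  have h2 : c ^ 2 * μ K = 1 ^ 2 * μ K := by
    conv_rhs => rw [h1]
    simp
  have h3 : c ^ 2 = 1 ^ 2 :=
    (ENNReal.mul_left_inj (Measure.measure_pos_of_nonempty_interior _ K.interior_nonempty).ne'
          K.isCompact.measure_lt_top.ne).1 h2
  have h4 : c = 1 := (ENNReal.pow_right_strictMono two_ne_zero).injective h3
  rw [hc, h4, one_smul]

/-- The two-sided translation `f ↦ f(g⁻¹ · h)` on `L¹`. -/
def translateL1 (μ : Measure G) [μ.IsHaarMeasure] [μ.IsMulRightInvariant] (g h : G) :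
    Lp ℝ 1 μ →ₗᵢ[ℝ] Lp ℝ 1 μ :=
  Lp.compMeasurePreservingₗᵢ ℝ (fun x => g⁻¹ * x * h) (measurePreserving_mul_mul g⁻¹ h)

theorem translateL1_toLp (g h : G) {f : G → ℝ} (hf : MemLp f 1 μ) :
    translateL1 μ g h (hf.toLp f) =
      (hf.comp_measurePreserving (measurePreserving_mul_mul g⁻¹ h)).toLp
        (fun x => f (g⁻¹ * x * h)) := rfl

theorem translateL1_mul (g h g' h' : G) (a : Lp ℝ 1 μ) :
    translateL1 μ (g * g') (h * h') a = translateL1 μ g h (translateL1 μ g' h' a) := by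
  obtain ⟨f, hf, rfl⟩ : ∃ (f : G → ℝ) (hf : MemLp f 1 μ), hf.toLp f = a :=
    ⟨a, Lp.memLp a, Lp.toLp_coeFn a _⟩
  simp only [translateL1_toLp]
  congr 1
  funext x
  simp only [mul_inv_rev, mul_assoc]

theorem translateL1_one (a : Lp ℝ 1 μ) : translateL1 μ 1 1 a = a := by
  obtain ⟨f, hf, rfl⟩ : ∃ (f : G → ℝ) (hf : MemLp f 1 μ), hf.toLp f = a :=
    ⟨a, Lp.memLp a, Lp.toLp_coeFn a _⟩
  simp only [translateL1_toLp]
  congr 1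
  funext x
  simp

theorem continuous_translateL1 (a : Lp ℝ 1 μ) :
    Continuous fun p : G × G => translateL1 μ p.1 p.2 a := by
  let k : C(G × G, C(G, G)) :=
    (ContinuousMap.mk (fun q : (G × G) × G => q.1.1⁻¹ * q.2 * q.1.2) (by fun_prop)).curry
  exact (continuous_const (y := a)).compMeasurePreservingLp k.continuous
    (fun p => measurePreserving_mul_mul p.1⁻¹ p.2) ENNReal.one_ne_top

theorem eventually_norm_translateL1_sub_le (a : Lp ℝ 1 μ) {ε : ℝ} (hε : 0 < ε) :
    ∀ᶠ y in 𝓝 (1 : G), ‖translateL1 μ y 1 a - a‖ ≤ ε := by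
  have hc : Continuous fun y : G => ‖translateL1 μ y 1 a - a‖ :=
    (((continuous_translateL1 a).comp (by fun_prop : Continuous fun y : G => (y, (1 : G)))).sub
      continuous_const).norm
  have := hc.tendsto 1
  rw [translateL1_one, sub_self, norm_zero] at this
  exact (this.eventually (gt_mem_nhds hε)).mono fun y hy => hy.le

/-- The class in `L¹` of a continuous function with compact support. -/
def ccToL1 (μ : Measure G) [μ.IsHaarMeasure] {f : G → ℝ} (hf : Continuous f)
    (hc : HasCompactSupport f) : Lp ℝ 1 μ :=
  (hf.memLp_of_hasCompactSupport hc).toLp f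

theorem continuous_comp_mul_mul {f : G → ℝ} (hf : Continuous f) (g h : G) :
    Continuous fun x => f (g⁻¹ * x * h) := by fun_prop

theorem hasCompactSupport_comp_mul_mul {f : G → ℝ} (hc : HasCompactSupport f) (g h : G) :
    HasCompactSupport fun x => f (g⁻¹ * x * h) :=
  hc.comp_homeomorph ((Homeomorph.mulLeft g⁻¹).trans (Homeomorph.mulRight h))

theorem translateL1_ccToL1 (g h : G) {f : G → ℝ} (hf : Continuous f)
    (hc : HasCompactSupport f) :
    translateL1 μ g h (ccToL1 μ hf hc) =
      ccToL1 μ (continuous_comp_mul_mul hf g h) (hasCompactSupport_comp_mul_mul hc g h) := rfl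

/-- Integration over a set as a functional on `L¹`. -/
def setIntegralL1 (μ : Measure G) (s : Set G) : Lp ℝ 1 μ →L[ℝ] ℝ :=
  L1.integralCLM.comp (LpToLpRestrictCLM G ℝ ℝ μ 1 s)

theorem setIntegralL1_apply (s : Set G) (a : Lp ℝ 1 μ) :
    setIntegralL1 μ s a = ∫ x in s, a x ∂μ := by
  have h : setIntegralL1 μ s a = L1.integral (LpToLpRestrictCLM G ℝ ℝ μ 1 s a) := by
    rw [L1.integral]; rfl
  rw [h, L1.integral_eq_integral]
  exact integral_congr_ae (LpToLpRestrictCLM_coeFn ℝ s a)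

theorem setIntegralL1_ccToL1 (s : Set G) {f : G → ℝ} (hf : Continuous f)
    (hc : HasCompactSupport f) : setIntegralL1 μ s (ccToL1 μ hf hc) = ∫ x in s, f x ∂μ := by
  rw [setIntegralL1_apply]
  exact integral_congr_ae (ae_restrict_of_ae (MemLp.coeFn_toLp _))

theorem integrable_smul_translateL1 {f : G → ℝ} (hf : Continuous f) (hc : HasCompactSupport f)
    {u : G → G × G} (hu : Continuous u) (a : Lp ℝ 1 μ) :
    Integrable (fun x => f x • translateL1 μ (u x).1 (u x).2 a) μ :=
  (hf.smul ((continuous_translateL1 a).comp hu)).integrable_of_hasCompactSupport hc.smul_right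

/-- Two ways of writing the convolution of two functions as an `L¹`-valued integral. -/
theorem integral_smul_translateL1_eq {f k : G → ℝ} (hf : Continuous f)
    (hfc : HasCompactSupport f) (hk : Continuous k) (hkc : HasCompactSupport k) :
    ∫ x, f x • translateL1 μ 1 x⁻¹ (ccToL1 μ hk hkc) ∂μ
      = ∫ y, k y • translateL1 μ y 1 (ccToL1 μ hf hfc) ∂μ := by
  have := isInvInvariant_of_isMulRightInvariant (μ := μ)
  set A := ∫ x, f x • translateL1 μ 1 x⁻¹ (ccToL1 μ hk hkc) ∂μ with hA
  set B := ∫ y, k y • translateL1 μ y 1 (ccToL1 μ hf hfc) ∂μ with hB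
  refine Lp.ext (Integrable.ae_eq_of_forall_setIntegral_eq _ _ (L1.integrable_coeFn A)
    (L1.integrable_coeFn B) fun s hs _ => ?_)
  rw [← setIntegralL1_apply, ← setIntegralL1_apply, hA, hB]
  rw [← (setIntegralL1 μ s).integral_comp_comm (integrable_smul_translateL1 hf hfc
      (u := fun x => (1, x⁻¹)) (by fun_prop) _),
    ← (setIntegralL1 μ s).integral_comp_comm (integrable_smul_translateL1 hk hkc
      (u := fun x => (x, 1)) (by fun_prop) _)]
  simp only [map_smul, translateL1_ccToL1, setIntegralL1_ccToL1, smul_eq_mul, inv_one, one_mul,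
    mul_one, ← integral_const_mul]
  have hK : IsCompact (tsupport k * tsupport f) := hkc.mul hfc
  have hsupp₁ : HasCompactSupport (Function.uncurry fun x y => f x * k (y * x⁻¹)) := by
    refine HasCompactSupport.intro (hfc.prod hK) ?_
    rintro ⟨x, y⟩ hxy
    by_contra hne
    have h1 : f x ≠ 0 := fun h => hne (by simp [h])
    have h2 : k (y * x⁻¹) ≠ 0 := fun h => hne (by simp [h])
    exact hxy ⟨subset_tsupport f h1, ⟨y * x⁻¹, subset_tsupport k h2, x, subset_tsupport f h1,
      by simp⟩⟩
  have hsupp₂ : HasCompactSupport (Function.uncurry fun x y => k x * f (x⁻¹ * y)) := by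
    refine HasCompactSupport.intro (hkc.prod hK) ?_
    rintro ⟨x, y⟩ hxy
    by_contra hne
    have h1 : k x ≠ 0 := fun h => hne (by simp [h])
    have h2 : f (x⁻¹ * y) ≠ 0 := fun h => hne (by simp [h])
    exact hxy ⟨subset_tsupport k h1, ⟨x, subset_tsupport k h1, x⁻¹ * y, subset_tsupport f h2,
      by simp⟩⟩
  -- After Fubini the inner integrals differ by the substitution x ↦ yx⁻¹, which preserves μ by
  -- unimodularity.
  rw [integral_integral_swap_of_hasCompactSupport (by fun_prop) hsupp₁,
    integral_integral_swap_of_hasCompactSupport (by fun_prop) hsupp₂]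
  congr 1
  funext y
  rw [← integral_div_left_eq_self (fun x => k x * f (x⁻¹ * y)) μ y]
  congr 1
  funext x
  simp [div_eq_mul_inv, mul_comm]

theorem exists_bump {U : Set G} (hU : U ∈ 𝓝 (1 : G)) :
    ∃ f : G → ℝ, Continuous f ∧ HasCompactSupport f ∧ 0 ≤ f ∧ ∫ x, f x ∂μ = 1 ∧
      ∀ x, f x ≠ 0 → x ∈ U := by
  obtain ⟨f, hf1, hf0, hfc, hfr⟩ := exists_continuous_one_zero_of_isCompact
    (isCompact_singleton (x := (1 : G))) isOpen_interior.isClosed_compl (t := (interior U)ᶜ)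
    (by simpa using mem_interior_iff_mem_nhds.2 hU)
  have hpos : 0 < ∫ x, f x ∂μ :=
    f.continuous.integral_pos_of_hasCompactSupport_nonneg_nonzero hfc (fun x => (hfr x).1)
      (x := 1) (by rw [hf1 rfl]; simp)
  refine ⟨fun x => (∫ x, f x ∂μ)⁻¹ * f x, by fun_prop, hfc.mul_left,
    fun x => mul_nonneg (inv_nonneg.2 hpos.le) (hfr x).1, ?_, fun x hx => ?_⟩
  · rw [integral_const_mul, inv_mul_cancel₀ hpos.ne']
  · by_contra hxU
    exact hx (by simp [hf0 (fun h => hxU (interior_subset h) : x ∈ (interior U)ᶜ)])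

/-- A bounded functional on `L¹` invariant under right translations is invariant under left
translations. -/
theorem map_translateL1_left_of_right (M : Lp ℝ 1 μ →L[ℝ] ℝ)
    (hM : ∀ h a, M (translateL1 μ 1 h a) = M a) (g : G) {f : G → ℝ} (hf : Continuous f)
    (hfc : HasCompactSupport f) :
    M (translateL1 μ g 1 (ccToL1 μ hf hfc)) = M (ccToL1 μ hf hfc) := by
  -- Apply M to both forms of the convolution: right invariance collapses one side to M(k) ∫ f.
  have key : ∀ {k : G → ℝ} (hk : Continuous k) (hkc : HasCompactSupport k) {f : G → ℝ}
      (hf : Continuous f) (hfc : HasCompactSupport f),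
      M (ccToL1 μ hk hkc) * ∫ x, f x ∂μ
        = ∫ y, k y * M (translateL1 μ y 1 (ccToL1 μ hf hfc)) ∂μ := by
    intro k hk hkc f hf hfc
    have h := congrArg M (integral_smul_translateL1_eq (μ := μ) hf hfc hk hkc)
    rw [← M.integral_comp_comm (integrable_smul_translateL1 hf hfc
      (u := fun x => (1, x⁻¹)) (by fun_prop) _),
      ← M.integral_comp_comm (integrable_smul_translateL1 hk hkc
      (u := fun x => (x, 1)) (by fun_prop) _)] at h
    simp only [map_smul, hM, smul_eq_mul] at h
    rw [← h, integral_mul_const, mul_comm]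
  have approx : ∀ {k : G → ℝ} (hk : Continuous k) (hkc : HasCompactSupport k), 0 ≤ k →
      ∫ x, k x ∂μ = 1 → ∀ {f : G → ℝ} (hf : Continuous f) (hfc : HasCompactSupport f) (ε : ℝ),
      (∀ y, k y ≠ 0 → ‖translateL1 μ y 1 (ccToL1 μ hf hfc) - ccToL1 μ hf hfc‖ ≤ ε) →
      |M (ccToL1 μ hk hkc) * ∫ x, f x ∂μ - M (ccToL1 μ hf hfc)| ≤ ‖M‖ * ε := by
    intro k hk hkc hk0 hk1 f hf hfc ε hε
    have e1 : M (ccToL1 μ hf hfc) = ∫ y, k y * M (ccToL1 μ hf hfc) ∂μ := by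
      rw [integral_mul_const, hk1, one_mul]
    have hi₁ : Integrable (fun y => k y * M (translateL1 μ y 1 (ccToL1 μ hf hfc))) μ := by
      have := M.integrable_comp (integrable_smul_translateL1 (μ := μ) hk hkc
        (u := fun x => (x, 1)) (by fun_prop) (ccToL1 μ hf hfc))
      simpa using this
    have hik : Integrable k μ := hk.integrable_of_hasCompactSupport hkc
    rw [key hk hkc hf hfc]
    rw [e1, ← integral_sub hi₁ (hik.mul_const _), ← Real.norm_eq_abs]
    have e2 : ‖M‖ * ε = ∫ y, k y * (‖M‖ * ε) ∂μ := by rw [integral_mul_const, hk1, one_mul]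
    rw [e2]
    refine norm_integral_le_of_norm_le (hik.mul_const _) (Eventually.of_forall fun y => ?_)
    rw [← mul_sub, ← map_sub, norm_mul, Real.norm_of_nonneg (hk0 y)]
    by_cases hy : k y = 0
    · simp [hy]
    · exact mul_le_mul_of_nonneg_left ((M.le_opNorm _).trans
        (mul_le_mul_of_nonneg_left (hε y hy) (norm_nonneg _))) (hk0 y)
  rw [translateL1_ccToL1]
  set hf' := continuous_comp_mul_mul hf g 1
  set hfc' := hasCompactSupport_comp_mul_mul hfc g 1
  have hint : ∫ x, f (g⁻¹ * x * 1) ∂μ = ∫ x, f x ∂μ := by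
    simp only [mul_one]; exact integral_mul_left_eq_self f g⁻¹
  have hle : ∀ ε : ℝ, 0 < ε → |M (ccToL1 μ hf' hfc') - M (ccToL1 μ hf hfc)| ≤ 2 * ‖M‖ * ε := by
    intro ε hε
    -- One approximate identity k serves f and its translate. Their integrals agree, so both values
    -- of M lie within ‖M‖ε of the same number M(k) ∫ f.
    obtain ⟨k, hk, hkc, hk0, hk1, hkU⟩ := exists_bump (μ := μ)
      ((eventually_norm_translateL1_sub_le (ccToL1 μ hf hfc) hε).and
        (eventually_norm_translateL1_sub_le (ccToL1 μ hf' hfc') hε))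
    have h1 := approx hk hkc hk0 hk1 hf hfc ε fun y hy => (hkU y hy).1
    have h2 := approx hk hkc hk0 hk1 hf' hfc' ε fun y hy => (hkU y hy).2
    rw [hint] at h2
    rw [abs_le] at h1 h2 ⊢
    constructor <;> linarith [h1.1, h1.2, h2.1, h2.2]
  rw [← sub_eq_zero, ← abs_nonpos_iff]
  refine le_of_forall_pos_le_add fun δ hδ => ?_
  rw [zero_add]
  -- The added 1 keeps the denominator positive when M = 0.
  refine (hle (δ / (2 * ‖M‖ + 1)) (by positivity)).trans ?_
  rw [← mul_div_assoc, div_le_iff₀ (by positivity)]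
  nlinarith [norm_nonneg M]

end Translation

/-! ### From invariant means to Reiter's condition. -/

section Reiter

open scoped BoundedContinuousFunction

variable {G : Type*} [Group G] [TopologicalSpace G] [IsTopologicalGroup G]
    [T2Space G] [LocallyCompactSpace G] [SecondCountableTopology G]
    [MeasurableSpace G] [BorelSpace G]
    {μ : Measure G} [μ.IsHaarMeasure] [μ.IsMulRightInvariant]

/-- An amenable group has a left-invariant mean on bounded continuous functions. -/
theorem IsAmenable.exists_mean (hG : IsAmenable μ) :
    ∃ m : (G →ᵇ ℝ) →ₗ[ℝ] ℝ, (∀ f, (∀ x, 0 ≤ f x) → 0 ≤ m f) ∧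
      m (BoundedContinuousFunction.const G 1) = 1 ∧
      ∀ (z : G) (f k : G →ᵇ ℝ), (∀ x, k x = f (z * x)) → m k = m f := by
  obtain ⟨m, hpos, hone, hinv⟩ := hG
  have hmem : ∀ f : G →ᵇ ℝ, MemLp f ∞ μ := fun f =>
    memLp_top_of_bound f.continuous.aestronglyMeasurable ‖f‖
      (Eventually.of_forall f.norm_coe_le_norm)
  let T : (G →ᵇ ℝ) →ₗ[ℝ] Lp ℝ ∞ μ :=
    { toFun := fun f => (hmem f).toLp f
      map_add' := fun _ _ => rfl
      map_smul' := fun _ _ => rfl }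
  refine ⟨m.comp T, fun f hf => hpos _ ?_, hone, fun z f k hk => ?_⟩
  · rw [← Lp.coeFn_nonneg]
    filter_upwards [(hmem f).coeFn_toLp] with x hx
    change 0 ≤ ((hmem f).toLp f : G → ℝ) x
    rw [hx]
    exact hf x
  · have : T k = leftTranslate μ z⁻¹ (T f) := by
      have e : (k : G → ℝ) = (f : G → ℝ) ∘ fun x => z⁻¹⁻¹ * x := by
        funext x; simp [hk]
      change (hmem k).toLp k = ((hmem f).comp_measurePreserving
        (measurePreserving_mul_left μ z⁻¹⁻¹)).toLp _
      congr 1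
    rw [LinearMap.comp_apply, LinearMap.comp_apply, this, hinv]

/-- The bounded continuous function `x ↦ Λ(a(· x⁻¹))`. -/
def orbitFunction (Λ : Lp ℝ 1 μ →L[ℝ] ℝ) (a : Lp ℝ 1 μ) : G →ᵇ ℝ :=
  BoundedContinuousFunction.ofNormedAddCommGroup (fun x => Λ (translateL1 μ 1 x⁻¹ a))
    (Λ.continuous.comp ((continuous_translateL1 a).comp (by fun_prop :
      Continuous fun x : G => ((1 : G), x⁻¹)))) (‖Λ‖ * ‖a‖)
    (fun x => (Λ.le_opNorm _).trans (by rw [LinearIsometry.norm_map]))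

theorem orbitFunction_apply (Λ : Lp ℝ 1 μ →L[ℝ] ℝ) (a : Lp ℝ 1 μ) (x : G) :
    orbitFunction Λ a x = Λ (translateL1 μ 1 x⁻¹ a) := rfl

theorem abs_mean_le {m : (G →ᵇ ℝ) →ₗ[ℝ] ℝ} (hpos : ∀ f, (∀ x, 0 ≤ f x) → 0 ≤ m f)
    (hone : m (BoundedContinuousFunction.const G 1) = 1) (f : G →ᵇ ℝ) {B : ℝ}
    (hB : ∀ x, |f x| ≤ B) : |m f| ≤ B := by
  have h1 := hpos (B • BoundedContinuousFunction.const G 1 - f) fun x => by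
    simpa using (abs_le.1 (hB x)).2
  have h2 := hpos (B • BoundedContinuousFunction.const G 1 + f) fun x => by
    have := (abs_le.1 (hB x)).1
    simp only [BoundedContinuousFunction.coe_add, Pi.add_apply,
      BoundedContinuousFunction.coe_smul, BoundedContinuousFunction.const_apply, smul_eq_mul]
    linarith
  rw [map_sub, map_smul, hone, smul_eq_mul] at h1
  rw [map_add, map_smul, hone, smul_eq_mul] at h2
  rw [abs_le]
  constructor <;> linarith

/-- Averaging Λ over right translates with m produces a bounded right-invariant functional on L¹;
`map_translateL1_left_of_right` makes it left-invariant on continuous functions of compact support.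
-/
theorem mean_orbitFunction_translateL1 {m : (G →ᵇ ℝ) →ₗ[ℝ] ℝ}
    (hpos : ∀ f, (∀ x, 0 ≤ f x) → 0 ≤ m f)
    (hone : m (BoundedContinuousFunction.const G 1) = 1)
    (hinv : ∀ (z : G) (f k : G →ᵇ ℝ), (∀ x, k x = f (z * x)) → m k = m f)
    (Λ : Lp ℝ 1 μ →L[ℝ] ℝ) (g : G) {f : G → ℝ} (hf : Continuous f)
    (hfc : HasCompactSupport f) :
    m (orbitFunction Λ (translateL1 μ g 1 (ccToL1 μ hf hfc)))
      = m (orbitFunction Λ (ccToL1 μ hf hfc)) := by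
  let M₀ : Lp ℝ 1 μ →ₗ[ℝ] ℝ :=
    { toFun := fun a => m (orbitFunction Λ a)
      map_add' := fun a b => by
        rw [← map_add]; congr 1; ext x; simp [orbitFunction_apply]
      map_smul' := fun c a => by
        rw [← map_smul]; congr 1; ext x; simp [orbitFunction_apply] }
  let M : Lp ℝ 1 μ →L[ℝ] ℝ := M₀.mkContinuous ‖Λ‖ fun a =>
    abs_mean_le hpos hone _ fun x => (Λ.le_opNorm _).trans (by rw [LinearIsometry.norm_map])
  refine map_translateL1_left_of_right M (fun h a => ?_) g hf hfc
  refine hinv h⁻¹ _ _ fun x => ?_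
  rw [orbitFunction_apply, orbitFunction_apply, ← translateL1_mul]
  simp

/-- Right translates of a function have convex combinations that are almost invariant under a
finite set of left translations. -/
theorem IsAmenable.exists_almost_invariant_finset (hG : IsAmenable μ) {f : G → ℝ}
    (hf : Continuous f) (hfc : HasCompactSupport f) (E : Finset G) {ε : ℝ} (hε : 0 < ε) :
    ∃ a ∈ convexHull ℝ (Set.range fun x => translateL1 μ 1 x⁻¹ (ccToL1 μ hf hfc)),
      ∀ g ∈ E, ‖translateL1 μ g 1 a - a‖ < ε := by
  classical
  obtain ⟨m, hpos, hone, hinv⟩ := hG.exists_mean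
  set S := convexHull ℝ (Set.range fun x => translateL1 μ 1 x⁻¹ (ccToL1 μ hf hfc)) with hS
  let T : Lp ℝ 1 μ →ₗ[ℝ] (E → Lp ℝ 1 μ) :=
    LinearMap.pi fun g => (translateL1 μ g.1 1).toLinearMap - LinearMap.id
  have hT : ∀ a g, T a g = translateL1 μ g.1 1 a - a := fun _ _ => rfl
  by_contra! hcon
  -- If no convex combination works, Hahn-Banach separates the defects from a ball around 0. The
  -- separating functional yields a function F ≥ u > 0 on G with m F = 0, contradicting positivity
  -- of the mean.
  have hdisj : Disjoint (Metric.ball (0 : E → Lp ℝ 1 μ) ε) (T '' S) := by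
    rw [Set.disjoint_right]
    rintro _ ⟨a, ha, rfl⟩ hball
    obtain ⟨g, hg, hge⟩ := hcon a ha
    rw [mem_ball_zero_iff] at hball
    exact absurd ((norm_le_pi_norm (T a) ⟨g, hg⟩).trans_lt hball) (not_lt.2 hge)
  obtain ⟨Λ, u, hΛ₁, hΛ₂⟩ := geometric_hahn_banach_open (convex_ball _ _) Metric.isOpen_ball
    ((convex_convexHull ℝ _).linear_image T) hdisj
  have hu : 0 < u := by simpa using hΛ₁ 0 (Metric.mem_ball_self hε)
  let Λ' : E → Lp ℝ 1 μ →L[ℝ] ℝ := fun g => Λ.comp (ContinuousLinearMap.single ℝ (fun _ : E => Lp ℝ 1 μ) g)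
  have hsum : ∀ w, Λ w = ∑ g, Λ' g (w g) := by
    intro w
    conv_lhs => rw [← Finset.univ_sum_single w]
    rw [map_sum]
    rfl
  let F : G →ᵇ ℝ := ∑ g : E, (orbitFunction (Λ' g) (translateL1 μ g.1 1 (ccToL1 μ hf hfc))
    - orbitFunction (Λ' g) (ccToL1 μ hf hfc))
  have hF0 : m F = 0 := by
    simp only [F, map_sum, map_sub]
    refine Finset.sum_eq_zero fun g _ => ?_
    rw [mean_orbitFunction_translateL1 hpos hone hinv, sub_self]
  have hFu : ∀ x, u ≤ F x := by
    intro x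
    refine (hΛ₂ _ ⟨_, subset_convexHull ℝ _ ⟨x, rfl⟩, rfl⟩).trans (le_of_eq ?_)
    rw [hsum, BoundedContinuousFunction.coe_sum, Finset.sum_apply]
    refine Finset.sum_congr rfl fun g _ => ?_
    rw [hT, map_sub, BoundedContinuousFunction.sub_apply, orbitFunction_apply,
      orbitFunction_apply, ← translateL1_mul, ← translateL1_mul]
    simp
  have h := hpos (F - u • BoundedContinuousFunction.const G 1) fun x => by
    simpa using hFu x
  rw [map_sub, map_smul, hone, hF0, smul_eq_mul] at h
  linarith

/-- Right translations are isometries commuting with left ones, and balls are convex. This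
equicontinuity is what upgrades finite sets of translations to compact ones. -/
theorem norm_translateL1_sub_le_of_mem_convexHull {a b : Lp ℝ 1 μ}
    (hb : b ∈ convexHull ℝ (Set.range fun x : G => translateL1 μ 1 x⁻¹ a)) (g : G) :
    ‖translateL1 μ g 1 b - b‖ ≤ ‖translateL1 μ g 1 a - a‖ := by
  let T : Lp ℝ 1 μ →ₗ[ℝ] Lp ℝ 1 μ := (translateL1 μ g 1).toLinearMap - LinearMap.id
  have hconv : Convex ℝ (T ⁻¹' Metric.closedBall 0 ‖translateL1 μ g 1 a - a‖) :=
    (convex_closedBall _ _).linear_preimage T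
  have := convexHull_min (s := Set.range fun x : G => translateL1 μ 1 x⁻¹ a) ?_ hconv hb
  · simpa [T] using this
  · rintro _ ⟨x, rfl⟩
    simp only [Set.mem_preimage, mem_closedBall_zero_iff]
    change ‖translateL1 μ g 1 (translateL1 μ 1 x⁻¹ a) - translateL1 μ 1 x⁻¹ a‖ ≤ _
    have : translateL1 μ g 1 (translateL1 μ 1 x⁻¹ a) = translateL1 μ 1 x⁻¹ (translateL1 μ g 1 a) := by
      rw [← translateL1_mul, ← translateL1_mul]; simp
    rw [this, ← map_sub, LinearIsometry.norm_map]

theorem exists_density_of_mem_convexHull {f : G → ℝ} (hf : Continuous f)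
    (hfc : HasCompactSupport f) (hf0 : 0 ≤ f) (hf1 : ∫ x, f x ∂μ = 1) {b : Lp ℝ 1 μ}
    (hb : b ∈ convexHull ℝ (Set.range fun x => translateL1 μ 1 x⁻¹ (ccToL1 μ hf hfc))) :
    ∃ (k : G → ℝ) (hk : Continuous k) (hkc : HasCompactSupport k), 0 ≤ k ∧
      ∫ x, k x ∂μ = 1 ∧ ccToL1 μ hk hkc = b := by
  refine convexHull_min (t := {b | ∃ (k : G → ℝ) (hk : Continuous k)
    (hkc : HasCompactSupport k), 0 ≤ k ∧ ∫ x, k x ∂μ = 1 ∧ ccToL1 μ hk hkc = b}) ?_ ?_ hb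
  · rintro _ ⟨x, rfl⟩
    refine ⟨_, continuous_comp_mul_mul hf 1 x⁻¹, hasCompactSupport_comp_mul_mul hfc 1 x⁻¹,
      fun y => hf0 (1⁻¹ * y * x⁻¹), ?_, rfl⟩
    simp only [inv_one, one_mul]
    rw [integral_mul_right_eq_self f, hf1]
  · rintro _ ⟨k, hk, hkc, hk0, hk1, rfl⟩ _ ⟨l, hl, hlc, hl0, hl1, rfl⟩ s t hs ht hst
    refine ⟨fun x => s * k x + t * l x, by fun_prop, hkc.mul_left.add hlc.mul_left,
      fun x => add_nonneg (mul_nonneg hs (hk0 x)) (mul_nonneg ht (hl0 x)), ?_, rfl⟩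
    rw [integral_add ((hk.integrable_of_hasCompactSupport hkc).const_mul _)
      ((hl.integrable_of_hasCompactSupport hlc).const_mul _), integral_const_mul,
      integral_const_mul, hk1, hl1, mul_one, mul_one, hst]

theorem ofReal_norm_ccToL1_translate_sub (g : G) {f : G → ℝ} (hf : Continuous f)
    (hfc : HasCompactSupport f) :
    ENNReal.ofReal ‖translateL1 μ g 1 (ccToL1 μ hf hfc) - ccToL1 μ hf hfc‖
      = ∫⁻ x, ‖f (g⁻¹ * x) - f x‖ₑ ∂μ := by
  rw [translateL1_ccToL1, L1.ofReal_norm_eq_lintegral]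
  refine lintegral_congr_ae ?_
  have h1 := Lp.coeFn_sub (ccToL1 μ (continuous_comp_mul_mul hf g 1)
    (hasCompactSupport_comp_mul_mul hfc g 1)) (ccToL1 μ hf hfc)
  have h2 : (ccToL1 μ (continuous_comp_mul_mul hf g 1)
    (hasCompactSupport_comp_mul_mul hfc g 1) : G → ℝ) =ᵐ[μ] _ := MemLp.coeFn_toLp _
  have h3 : (ccToL1 μ hf hfc : G → ℝ) =ᵐ[μ] f := MemLp.coeFn_toLp _
  filter_upwards [h1, h2, h3] with x h1 h2 h3
  rw [h1, Pi.sub_apply, h2, h3, mul_one]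

/-- Reiter's condition: an amenable group has continuous compactly supported densities that are
almost invariant under left translations, uniformly on compact sets. -/
theorem IsAmenable.exists_reiter (hG : IsAmenable μ) {C : Set G} (hC : IsCompact C) {ε : ℝ}
    (hε : 0 < ε) :
    ∃ f : G → ℝ, Continuous f ∧ HasCompactSupport f ∧ 0 ≤ f ∧ ∫ x, f x ∂μ = 1 ∧
      ∀ g ∈ C, ∫⁻ x, ‖f (g⁻¹ * x) - f x‖ₑ ∂μ ≤ ENNReal.ofReal ε := by
  obtain ⟨φ, hφ, hφc, hφ0, hφ1, -⟩ := exists_bump (μ := μ) (G := G) univ_mem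
  have hU := eventually_norm_translateL1_sub_le (ccToL1 μ hφ hφc) (half_pos hε)
  set U := {y : G | ‖translateL1 μ y 1 (ccToL1 μ hφ hφc) - ccToL1 μ hφ hφc‖ ≤ ε / 2} with hUdef
  -- Cover C by finitely many eU. Half of ε goes to the motion of b by e, half to its motion by e⁻¹g
  -- ∈ U.
  obtain ⟨E, -, hE⟩ := hC.elim_nhds_subcover (fun g => (fun x => g⁻¹ * x) ⁻¹' U) (fun g _ =>
    (by fun_prop : Continuous fun x : G => g⁻¹ * x).continuousAt.preimage_mem_nhds
      (by rw [inv_mul_cancel]; exact hU))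
  obtain ⟨b, hb, hbE⟩ := hG.exists_almost_invariant_finset hφ hφc E (half_pos hε)
  obtain ⟨f, hf, hfc, hf0, hf1, rfl⟩ := exists_density_of_mem_convexHull hφ hφc hφ0 hφ1 hb
  refine ⟨f, hf, hfc, hf0, hf1, fun g hg => ?_⟩
  rw [← ofReal_norm_ccToL1_translate_sub g hf hfc]
  refine ENNReal.ofReal_le_ofReal ?_
  obtain ⟨e, he, hge⟩ := Set.mem_iUnion₂.1 (hE hg)
  set b := ccToL1 μ hf hfc
  have h1 : ‖translateL1 μ (e⁻¹ * g) 1 b - b‖ ≤ ε / 2 :=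
    (norm_translateL1_sub_le_of_mem_convexHull hb _).trans hge
  have h2 : translateL1 μ g 1 b - b
      = translateL1 μ e 1 (translateL1 μ (e⁻¹ * g) 1 b - b) + (translateL1 μ e 1 b - b) := by
    rw [map_sub, ← translateL1_mul]; simp
  rw [h2]
  refine (norm_add_le _ _).trans ?_
  rw [LinearIsometry.norm_map]
  linarith [hbE e he]

end Reiter

/-! ### Two-sided densities, superlevel sets and Følner sets. -/

section LevelSets

open scoped Pointwise

variable {G : Type*} [Group G] [TopologicalSpace G] [IsTopologicalGroup G]
    [T2Space G] [LocallyCompactSpace G] [SecondCountableTopology G]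
    [MeasurableSpace G] [BorelSpace G]
    {μ : Measure G} [μ.IsHaarMeasure] [μ.IsMulRightInvariant]

theorem lintegral_inv_mul_eq_self (u : G → ℝ≥0∞) (x : G) :
    ∫⁻ y, u (y⁻¹ * x) ∂μ = ∫⁻ y, u y ∂μ := by
  have := isInvInvariant_of_isMulRightInvariant (μ := μ)
  rw [lintegral_inv_eq_self (fun y => u (y * x)), lintegral_mul_right_eq_self]

theorem lintegral_lintegral_mul_inv_mul {u w : G → ℝ≥0∞} (hu : Measurable u)
    (hw : Measurable w) :
    ∫⁻ y, ∫⁻ x, u x * w (y⁻¹ * x) ∂μ ∂μ = (∫⁻ x, u x ∂μ) * ∫⁻ x, w x ∂μ := by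
  rw [lintegral_lintegral_swap (by fun_prop)]
  have : ∀ x, ∫⁻ y, u x * w (y⁻¹ * x) ∂μ = u x * ∫⁻ y, w y ∂μ := fun x => by
    rw [lintegral_const_mul _ (by fun_prop), lintegral_inv_mul_eq_self]
  simp_rw [this]
  rw [lintegral_mul_const _ hu]

theorem lintegral_enorm_integral_mul_inv_mul_le {u w : G → ℝ} (hu : Continuous u)
    (hw : Continuous w) :
    ∫⁻ y, ‖∫ x, u x * w (y⁻¹ * x) ∂μ‖ₑ ∂μ ≤ (∫⁻ x, ‖u x‖ₑ ∂μ) * ∫⁻ x, ‖w x‖ₑ ∂μ := by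
  rw [← lintegral_lintegral_mul_inv_mul (hu.measurable.enorm) (hw.measurable.enorm)]
  refine lintegral_mono fun y => (enorm_integral_le_lintegral_enorm _).trans (le_of_eq ?_)
  simp_rw [enorm_mul]

/-- Continuous compactly supported densities, maximal at the identity, that are almost invariant
under left and right translations. -/
theorem IsAmenable.exists_two_sided_density (hG : IsAmenable μ) {C : Set G} (hC : IsCompact C)
    {ε : ℝ} (hε : 0 < ε) :
    ∃ k : G → ℝ, Continuous k ∧ HasCompactSupport k ∧ 0 ≤ k ∧
      ∫⁻ x, ENNReal.ofReal (k x) ∂μ = 1 ∧ (∀ y, k y ≤ k 1) ∧ ∀ g ∈ C,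
        ∫⁻ x, ‖k (g⁻¹ * x) - k x‖ₑ ∂μ ≤ ENNReal.ofReal ε ∧
        ∫⁻ x, ‖k (x * g) - k x‖ₑ ∂μ ≤ ENNReal.ofReal ε := by
  obtain ⟨f, hf, hfc, hf0, hf1, hfC⟩ := hG.exists_reiter hC hε
  have hmul : ∀ {u w : G → ℝ}, Continuous u → Continuous w → HasCompactSupport u → ∀ y,
      Integrable (fun x => u x * w (y⁻¹ * x)) μ := fun hu hw huc y =>
    (by fun_prop : Continuous _).integrable_of_hasCompactSupport huc.mul_right
  have hfe : ∫⁻ x, ‖f x‖ₑ ∂μ = 1 := by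
    have h := ofReal_integral_eq_lintegral_ofReal (hf.integrable_of_hasCompactSupport hfc (μ := μ))
      (Eventually.of_forall hf0)
    rw [hf1, ENNReal.ofReal_one] at h
    rw [h]
    exact lintegral_congr fun x => Real.enorm_of_nonneg (hf0 x)
  have hfg : ∀ g : G, HasCompactSupport fun x => f (g⁻¹ * x) := fun g => by
    simpa using hasCompactSupport_comp_mul_mul hfc g 1
  -- A left or right translation of k becomes a left translation of one of the two factors f, so
  -- left almost invariance of f controls both sides.
  set k : G → ℝ := fun y => ∫ x, f x * f (y⁻¹ * x) ∂μ with hk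
  have hk0 : 0 ≤ k := fun y => integral_nonneg fun x => mul_nonneg (hf0 _) (hf0 _)
  refine ⟨k, ?_, ?_, hk0, ?_, fun y => ?_, fun g hg => ⟨?_, ?_⟩⟩
  · have : k = fun y => ∫ x in tsupport f, f x * f (y⁻¹ * x) ∂μ := by
      funext y
      refine (setIntegral_eq_integral_of_forall_compl_eq_zero fun x hx => ?_).symm
      rw [image_eq_zero_of_notMem_tsupport hx, zero_mul]
    rw [this]
    exact continuous_parametric_integral_of_continuous (by fun_prop) hfc
  · refine HasCompactSupport.intro (hfc.isCompact.mul hfc.isCompact.inv) fun y hy => ?_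
    refine integral_eq_zero_of_ae (Eventually.of_forall fun x => ?_)
    by_contra hne
    have h1 : f x ≠ 0 := fun h => hne (by simp [h])
    have h2 : f (y⁻¹ * x) ≠ 0 := fun h => hne (by simp [h])
    exact hy ⟨x, subset_tsupport f h1, (y⁻¹ * x)⁻¹, Set.inv_mem_inv.2 (subset_tsupport f h2),
      by simp⟩
  · have : ∀ y, ENNReal.ofReal (k y) = ∫⁻ x, ‖f x‖ₑ * ‖f (y⁻¹ * x)‖ₑ ∂μ := by
      intro y
      rw [hk, ofReal_integral_eq_lintegral_ofReal (hmul hf hf hfc y)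
        (Eventually.of_forall fun x => mul_nonneg (hf0 _) (hf0 _))]
      refine lintegral_congr fun x => ?_
      rw [← enorm_mul, Real.enorm_of_nonneg (mul_nonneg (hf0 _) (hf0 _))]
    simp_rw [this]
    rw [lintegral_lintegral_mul_inv_mul (u := fun x => ‖f x‖ₑ) (w := fun x => ‖f x‖ₑ)
      hf.measurable.enorm hf.measurable.enorm, hfe, one_mul]
  · have hsq : Integrable (fun x => f x * f x) μ :=
      (by fun_prop : Continuous _).integrable_of_hasCompactSupport hfc.mul_right
    have h1 : k 1 = ∫ x, f x * f x ∂μ := by simp [hk]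
    have h2 : ∫ x, f (y⁻¹ * x) * f (y⁻¹ * x) ∂μ = ∫ x, f x * f x ∂μ :=
      integral_mul_left_eq_self (fun x => f x * f x) y⁻¹
    -- Maximality at 1: ab ≤ (a² + b²)/2 and translation invariance.
    have h3 : k y ≤ ∫ x, (2⁻¹ * (f x * f x) + 2⁻¹ * (f (y⁻¹ * x) * f (y⁻¹ * x))) ∂μ := by
      refine integral_mono (hmul hf hf hfc y) ((hsq.const_mul _).add
        ((hsq.comp_mul_left y⁻¹).const_mul _)) fun x => ?_
      simp only
      nlinarith [sq_nonneg (f x - f (y⁻¹ * x))]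
    rw [integral_add (hsq.const_mul _) ((hsq.comp_mul_left y⁻¹).const_mul _),
      integral_const_mul, integral_const_mul, h2] at h3
    rw [h1]
    linarith
  · have : ∀ y, k (g⁻¹ * y) - k y = ∫ x, (f (g⁻¹ * x) - f x) * f (y⁻¹ * x) ∂μ := by
      intro y
      have e : k (g⁻¹ * y) = ∫ x, f (g⁻¹ * x) * f (y⁻¹ * x) ∂μ := by
        rw [← integral_mul_left_eq_self (fun x => f (g⁻¹ * x) * f (y⁻¹ * x)) g]
        simp [hk, mul_assoc]
      rw [e, hk, ← integral_sub (hmul (by fun_prop) hf (hfg g) y) (hmul hf hf hfc y)]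
      simp_rw [sub_mul]
    simp_rw [this]
    refine (lintegral_enorm_integral_mul_inv_mul_le (by fun_prop) hf).trans ?_
    rw [hfe, mul_one]
    exact hfC g hg
  · have : ∀ y, k (y * g) - k y = ∫ x, f x * (fun z => f (g⁻¹ * z) - f z) (y⁻¹ * x) ∂μ := by
      intro y
      have e : k (y * g) = ∫ x, f x * f (g⁻¹ * (y⁻¹ * x)) ∂μ := by simp [hk, mul_assoc]
      rw [e, hk, ← integral_sub (hmul (w := fun z => f (g⁻¹ * z)) hf (by fun_prop) hfc y)
        (hmul hf hf hfc y)]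
      simp_rw [mul_sub]
    simp_rw [this]
    refine (lintegral_enorm_integral_mul_inv_mul_le (w := fun z => f (g⁻¹ * z) - f z) hf
      (by fun_prop)).trans ?_
    rw [hfe, one_mul]
    exact hfC g hg

/-- The measure of `g F h⁻¹ ∆ F`. -/
def shiftDefect (μ : Measure G) (F : Set G) (g h : G) : ℝ≥0∞ :=
  μ (((fun x => g⁻¹ * x * h) ⁻¹' F) ∆ F)

theorem measure_image_mul_mul_symmDiff (F : Set G) (g h : G) :
    μ (((fun x => g * x * h⁻¹) '' F) ∆ F) = shiftDefect μ F g h := by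
  rw [shiftDefect]
  congr 2
  ext x
  constructor
  · rintro ⟨y, hy, rfl⟩
    simpa [mul_assoc] using hy
  · intro hx
    exact ⟨_, hx, by simp [mul_assoc]⟩

/-- Triangle inequality for the measure of symmetric differences, one term being translated back by
invariance of μ. -/
theorem shiftDefect_mul_le {F : Set G} (hF : MeasurableSet F) (g h g' h' : G) :
    shiftDefect μ F (g * g') (h * h') ≤ shiftDefect μ F g h + shiftDefect μ F g' h' := by
  have hm : ∀ a b : G, MeasurableSet ((fun x => a⁻¹ * x * b) ⁻¹' F) := fun a b =>
    (measurePreserving_mul_mul (μ := μ) a⁻¹ b).measurable hF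
  have e : shiftDefect μ F g' h' = μ (((fun x => (g * g')⁻¹ * x * (h * h')) ⁻¹' F) ∆
      ((fun x => g⁻¹ * x * h) ⁻¹' F)) := by
    rw [shiftDefect, ← (measurePreserving_mul_mul (μ := μ) g⁻¹ h).measure_preimage
      ((hm g' h').symmDiff hF).nullMeasurableSet, Set.preimage_symmDiff, ← Set.preimage_comp]
    congr 3
    funext x
    simp [mul_assoc]
  rw [e, add_comm]
  exact measure_symmDiff_le _ _ _

theorem shiftDefect_inv {F : Set G} (hF : MeasurableSet F) (g h : G) :
    shiftDefect μ F g⁻¹ h⁻¹ = shiftDefect μ F g h := by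
  have hm : ∀ a b : G, MeasurableSet ((fun x => a⁻¹ * x * b) ⁻¹' F) := fun a b =>
    (measurePreserving_mul_mul (μ := μ) a⁻¹ b).measurable hF
  rw [shiftDefect, ← (measurePreserving_mul_mul (μ := μ) g⁻¹ h).measure_preimage
    ((hm g⁻¹ h⁻¹).symmDiff hF).nullMeasurableSet, Set.preimage_symmDiff, ← Set.preimage_comp,
    symmDiff_comm, shiftDefect]
  congr 2
  ext x
  simp [mul_assoc]

/-- By Tonelli: for fixed x, the levels t at which x is in exactly one superlevel set lie in the
interval between u x and w x. -/
theorem lintegral_measure_symmDiff_le {u w : G → ℝ} (hu : Measurable u) (hw : Measurable w) :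
    ∫⁻ t in Set.Ioi (0 : ℝ), μ ({x | t ≤ u x} ∆ {x | t ≤ w x}) ≤ ∫⁻ x, ‖u x - w x‖ₑ ∂μ := by
  have hS : MeasurableSet ({p : ℝ × G | p.1 ≤ u p.2} ∆ {p : ℝ × G | p.1 ≤ w p.2}) :=
    (measurableSet_le (by fun_prop) (by fun_prop)).symmDiff
      (measurableSet_le (by fun_prop) (by fun_prop))
  refine (setLIntegral_le_lintegral _ _).trans ?_
  have h1 := Measure.prod_apply (μ := volume) (ν := μ) hS
  have h2 := Measure.prod_apply_symm (μ := volume) (ν := μ) hS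
  refine (h1.symm.trans h2).le.trans (lintegral_mono fun x => ?_)
  have hsub : (fun t => (t, x)) ⁻¹' ({p : ℝ × G | p.1 ≤ u p.2} ∆ {p : ℝ × G | p.1 ≤ w p.2})
      ⊆ Set.uIoc (u x) (w x) := by
    intro t ht
    rw [Set.mem_uIoc]
    rcases ht with ⟨h, h'⟩ | ⟨h, h'⟩
    · exact Or.inr ⟨not_le.1 h', h⟩
    · exact Or.inl ⟨not_le.1 h', h⟩
  refine (measure_mono hsub).trans ?_
  rw [Real.volume_uIoc, enorm_sub_rev, Real.enorm_eq_ofReal_abs]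

theorem measurable_shiftDefect_level {k : G → ℝ} (hk : Continuous k) :
    Measurable fun p : ℝ × G × G => shiftDefect μ {x | p.1 ≤ k x} p.2.1 p.2.2 := by
  have h1 : Measurable fun q : (ℝ × G × G) × G => k (q.1.2.1⁻¹ * q.2 * q.1.2.2) :=
    (by fun_prop : Continuous fun q : (ℝ × G × G) × G => k (q.1.2.1⁻¹ * q.2 * q.1.2.2)).measurable
  have h2 : Measurable fun q : (ℝ × G × G) × G => k q.2 := hk.measurable.comp measurable_snd
  have h3 : Measurable fun q : (ℝ × G × G) × G => q.1.1 := measurable_fst.comp measurable_fst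
  exact measurable_measure_prodMk_left ((measurableSet_le h3 h1).symmDiff (measurableSet_le h3 h2))

theorem measurable_shiftDefect_level_add {k : G → ℝ} (hk : Continuous k) :
    Measurable fun p : ℝ × G => shiftDefect μ {x | p.1 ≤ k x} p.2 1
      + shiftDefect μ {x | p.1 ≤ k x} 1 p.2 := by
  have h1 : Measurable fun p : ℝ × G => (p.1, p.2, (1 : G)) :=
    measurable_fst.prodMk (measurable_snd.prodMk measurable_const)
  have h2 : Measurable fun p : ℝ × G => (p.1, (1 : G), p.2) :=
    measurable_fst.prodMk (measurable_const.prodMk measurable_snd)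
  have h3 := Measurable.comp (measurable_shiftDefect_level (μ := μ) hk) h1
  have h4 := Measurable.comp (measurable_shiftDefect_level (μ := μ) hk) h2
  simp only [Function.comp_def] at h3 h4
  exact h3.add h4

/-- If every level failed, integrating over t would give c = c ∫ k ≤ 2 ε μ(K), against `hc`. -/
theorem exists_level_set {k : G → ℝ} (hk : Continuous k) (hk0 : 0 ≤ k)
    (hk1 : ∫⁻ x, ENNReal.ofReal (k x) ∂μ = 1) (hmax : ∀ y, k y ≤ k 1) {K : Set G} {ε c : ℝ≥0∞}
    (hK : MeasurableSet K)
    (hε : ∀ g ∈ K, ∫⁻ x, ‖k (g⁻¹ * x) - k x‖ₑ ∂μ ≤ ε ∧ ∫⁻ x, ‖k (x * g) - k x‖ₑ ∂μ ≤ ε)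
    (hc : 2 * ε * μ K < c) :
    ∃ t, 0 < t ∧ t < k 1 ∧
      ∫⁻ g in K, (shiftDefect μ {x | t ≤ k x} g 1 + shiftDefect μ {x | t ≤ k x} 1 g) ∂μ
        ≤ c * μ {x | t ≤ k x} := by
  by_contra! hcon
  have hmeas : Measurable fun p : ℝ × G => shiftDefect μ {x | p.1 ≤ k x} p.2 1
      + shiftDefect μ {x | p.1 ≤ k x} 1 p.2 := measurable_shiftDefect_level_add hk
  have hae : ∀ᵐ t ∂(volume.restrict (Set.Ioi (0 : ℝ))), c * μ {x | t ≤ k x}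
      ≤ ∫⁻ g in K, (shiftDefect μ {x | t ≤ k x} g 1 + shiftDefect μ {x | t ≤ k x} 1 g) ∂μ := by
    -- The level k(1) is negligible and higher superlevel sets are empty, so restricting to t < k(1)
    -- costs nothing.
    have hne : ∀ᵐ t ∂(volume : Measure ℝ), t ≠ k 1 := by simp [ae_iff]
    filter_upwards [ae_restrict_mem measurableSet_Ioi, ae_restrict_of_ae hne] with t ht htne
    rcases lt_or_gt_of_ne htne with h | h
    · exact (hcon t ht h).le
    · have : {x | t ≤ k x} = ∅ := by
        ext x
        simpa using (hmax x).trans_lt h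
      simp [this]
  have h1 := lintegral_mono_ae hae
  have hlc := lintegral_eq_lintegral_meas_le μ (Eventually.of_forall hk0) hk.measurable.aemeasurable
  have hmm : Measurable fun t : ℝ => μ {x | t ≤ k x} :=
    (Antitone.measurable fun s t hst => measure_mono fun x (hx : t ≤ k x) => hst.trans hx)
  rw [lintegral_const_mul _ hmm, ← hlc, hk1, mul_one,
    lintegral_lintegral_swap hmeas.aemeasurable] at h1
  refine absurd (h1.trans ?_) (not_le.2 hc)
  have h2 : ∀ g ∈ K, ∫⁻ t in Set.Ioi (0 : ℝ), (shiftDefect μ {x | t ≤ k x} g 1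
      + shiftDefect μ {x | t ≤ k x} 1 g) ≤ 2 * ε := by
    intro g hg
    have hml := Measurable.comp (measurable_shiftDefect_level (μ := μ) hk)
      (measurable_id.prodMk measurable_const : Measurable fun t : ℝ => (t, g, (1 : G)))
    simp only [Function.comp_def, id_eq] at hml
    rw [lintegral_add_left hml, two_mul]
    refine add_le_add (le_trans ?_ (hε g hg).1) (le_trans ?_ (hε g hg).2)
    · simpa [shiftDefect] using lintegral_measure_symmDiff_le (μ := μ)
        (u := fun x => k (g⁻¹ * x)) (w := k) (by fun_prop) (by fun_prop)
    · simpa [shiftDefect] using lintegral_measure_symmDiff_le (μ := μ)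
        (u := fun x => k (x * g)) (w := k) (by fun_prop) (by fun_prop)
  refine (setLIntegral_mono' hK h2).trans (le_of_eq ?_)
  rw [setLIntegral_const]

/-- A set that is almost invariant on average over `K` is almost invariant uniformly over `C`
as soon as `K ⊇ K₀ ∪ C K₀`. -/
theorem shiftDefect_le_of_average {F K₀ K C : Set G} (hF : MeasurableSet F) (hF0 : μ F ≠ 0)
    (hFt : μ F ≠ ∞) (hK₀ : K₀ ⊆ K) (hCK : C * K₀ ⊆ K) {c δ : ℝ≥0∞}
    (hδ0 : δ ≠ 0) (hδt : δ ≠ ∞) (hcδ : 2 * (c / δ) < μ K₀)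
    (hm : Measurable fun g => shiftDefect μ F g 1 + shiftDefect μ F 1 g)
    (hint : ∫⁻ g in K, (shiftDefect μ F g 1 + shiftDefect μ F 1 g) ∂μ ≤ c * μ F) {g : G}
    (hg : g ∈ C) :
    shiftDefect μ F g 1 + shiftDefect μ F 1 g ≤ 2 * (δ * μ F) := by
  set r : G → ℝ≥0∞ := fun g => shiftDefect μ F g 1 + shiftDefect μ F 1 g with hr
  set B : Set G := {x | δ * μ F ≤ r x} ∩ K with hB
  have hBle : μ B ≤ c / δ := by
    have h1 := (mul_meas_ge_le_lintegral (μ := μ.restrict K) hm (δ * μ F)).trans hint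
    rw [Measure.restrict_apply (measurableSet_le measurable_const hm)] at h1
    rw [ENNReal.le_div_iff_mul_le (Or.inl hδ0) (Or.inl hδt)]
    refine (ENNReal.mul_le_mul_iff_left hF0 hFt).1 ?_
    calc μ B * δ * μ F = δ * μ F * μ B := by ring
      _ ≤ c * μ F := h1
  obtain ⟨b, hbK, hb⟩ : ∃ b ∈ K₀, b ∉ B ∧ g * b ∉ B := by
    by_contra! hcon
    -- By Chebyshev 2 μ(B) < μ(K₀), so some b ∈ K₀ has both b and gb outside the bad set; then g =
    -- (gb)b⁻¹ inherits the bound.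
    have hsub : K₀ ⊆ B ∪ (fun x => g * x) ⁻¹' B := by
      intro b hb
      by_cases h : b ∈ B
      · exact Or.inl h
      · exact Or.inr (hcon b hb h)
    have := (measure_mono hsub).trans (measure_union_le (μ := μ) _ _)
    rw [measure_preimage_mul] at this
    refine absurd (this.trans ?_) (not_le.2 hcδ)
    rw [← two_mul]
    gcongr
  have hrb : r b ≤ δ * μ F := by
    by_contra h
    exact hb.1 ⟨(not_le.1 h).le, hK₀ hbK⟩
  have hrgb : r (g * b) ≤ δ * μ F := by
    by_contra h
    exact hb.2 ⟨(not_le.1 h).le, hCK (Set.mul_mem_mul hg hbK)⟩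
  have h1 := shiftDefect_mul_le (μ := μ) hF (g * b) 1 b⁻¹ 1
  have h2 := shiftDefect_mul_le (μ := μ) hF 1 (g * b) 1 b⁻¹
  have h3 := shiftDefect_inv (μ := μ) hF b 1
  have h4 := shiftDefect_inv (μ := μ) hF 1 b
  simp only [mul_inv_cancel_right, mul_one, inv_one] at h1 h2 h3 h4
  rw [h3] at h1
  rw [h4] at h2
  calc shiftDefect μ F g 1 + shiftDefect μ F 1 g
      ≤ (shiftDefect μ F (g * b) 1 + shiftDefect μ F b 1)
        + (shiftDefect μ F 1 (g * b) + shiftDefect μ F 1 b) := add_le_add h1 h2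
    _ = r (g * b) + r b := by simp only [hr]; ring
    _ ≤ 2 * (δ * μ F) := by rw [two_mul]; exact add_le_add hrgb hrb

/-- Compact neighbourhoods of the identity that are almost invariant under two-sided
translations by a compact set. -/
theorem IsAmenable.exists_almost_invariant_set (hG : IsAmenable μ) {C : Set G}
    (hC : IsCompact C) {δ : ℝ} (hδ : 0 < δ) :
    ∃ F : Set G, IsCompact F ∧ F ∈ 𝓝 (1 : G) ∧
      ∀ g ∈ C, ∀ h ∈ C, shiftDefect μ F g h ≤ ENNReal.ofReal (4 * δ) * μ F := by
  obtain ⟨K₀, hK₀, hK₀1⟩ := exists_compact_mem_nhds (1 : G)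
  set K := C * K₀ ∪ K₀ with hKdef
  have hK : IsCompact K := (hC.mul hK₀).union hK₀
  have hκ₀ : 0 < μ.real K₀ := ENNReal.toReal_pos (Measure.measure_pos_of_mem_nhds μ hK₀1).ne'
    hK₀.measure_lt_top.ne
  have hκ : 0 < μ.real K := hκ₀.trans_le (measureReal_mono Set.subset_union_right
    hK.measure_lt_top.ne)
  have hμK : μ K = ENNReal.ofReal (μ.real K) := (ofReal_measureReal hK.measure_lt_top.ne).symm
  have hμK₀ : μ K₀ = ENNReal.ofReal (μ.real K₀) :=
    (ofReal_measureReal hK₀.measure_lt_top.ne).symm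
  -- With c = δ μ(K₀)/4 this gives 2 ε μ(K) = c/2 < c for the level set, and 2c/δ = μ(K₀)/2 < μ(K₀)
  -- for Chebyshev.
  set ε : ℝ := δ * μ.real K₀ / (16 * μ.real K) with hε
  have hε0 : 0 < ε := by positivity
  obtain ⟨k, hk, hkc, hk0, hk1, hmax, hkC⟩ := hG.exists_two_sided_density hK hε0
  obtain ⟨t, ht0, ht1, ht⟩ := exists_level_set hk hk0 hk1 hmax hK.measurableSet hkC
    (c := ENNReal.ofReal (δ * μ.real K₀ / 4)) (by
      rw [hμK, ← ENNReal.ofReal_ofNat 2, ← ENNReal.ofReal_mul (by norm_num),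
        ← ENNReal.ofReal_mul (by positivity)]
      refine (ENNReal.ofReal_lt_ofReal_iff (by positivity)).2 ?_
      have : 2 * ε * μ.real K = δ * μ.real K₀ / 8 := by rw [hε]; field_simp; norm_num
      rw [this]
      have := mul_pos hδ hκ₀
      linarith)
  set F := {x | t ≤ k x} with hFdef
  have hFcl : IsClosed F := isClosed_le continuous_const hk
  have hFc : IsCompact F := hkc.isCompact.of_isClosed_subset hFcl fun x (hx : t ≤ k x) =>
    subset_tsupport k (ht0.trans_le hx).ne'
  have hF1 : F ∈ 𝓝 (1 : G) := (hk.continuousAt.eventually (lt_mem_nhds ht1)).mono fun x hx => hx.le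
  have hFpos : μ F ≠ 0 := (Measure.measure_pos_of_mem_nhds μ hF1).ne'
  have hmeas := Measurable.comp (measurable_shiftDefect_level_add (μ := μ) hk)
    (measurable_const.prodMk measurable_id : Measurable fun g : G => (t, g))
  simp only [Function.comp_def] at hmeas
  have hδ' : ENNReal.ofReal δ ≠ 0 := (ENNReal.ofReal_pos.2 hδ).ne'
  have hr : ∀ g ∈ C, shiftDefect μ F g 1 + shiftDefect μ F 1 g ≤ 2 * (ENNReal.ofReal δ * μ F) :=
    fun g hg => shiftDefect_le_of_average hFc.measurableSet hFpos hFc.measure_lt_top.ne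
      Set.subset_union_right Set.subset_union_left hδ' ENNReal.ofReal_ne_top (by
        rw [← ENNReal.ofReal_div_of_pos hδ, hμK₀, ← ENNReal.ofReal_ofNat 2,
          ← ENNReal.ofReal_mul (by norm_num)]
        refine (ENNReal.ofReal_lt_ofReal_iff hκ₀).2 ?_
        have : 2 * (δ * μ.real K₀ / 4 / δ) = μ.real K₀ / 2 := by field_simp; norm_num
        rw [this]
        linarith) hmeas ht hg
  refine ⟨F, hFc, hF1, fun g hg h hh => ?_⟩
  have h1 := shiftDefect_mul_le (μ := μ) hFc.measurableSet g 1 1 h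
  rw [mul_one, one_mul] at h1
  calc shiftDefect μ F g h ≤ shiftDefect μ F g 1 + shiftDefect μ F 1 h := h1
    _ ≤ 2 * (ENNReal.ofReal δ * μ F) + 2 * (ENNReal.ofReal δ * μ F) :=
      add_le_add (le_self_add.trans (hr g hg)) (le_add_self.trans (hr h hh))
    _ = ENNReal.ofReal (4 * δ) * μ F := by
      rw [ENNReal.ofReal_mul (by norm_num), ENNReal.ofReal_ofNat]; ring

theorem exists_isGroupFolner_mem_nhds_one (μ : Measure G) [μ.IsHaarMeasure]
    [μ.IsMulRightInvariant] (hG : IsAmenable μ) :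
    ∃ F : ℕ → Set G, IsGroupFolner μ F ∧ ∀ n, F n ∈ 𝓝 (1 : G) := by
  let E : CompactExhaustion G := default
  -- Chosen so that 4δ = 1/(n+1); any compact set lies in the exhaustion from some stage on.
  have hδ : ∀ n : ℕ, 0 < (4 * (n + 1 : ℝ))⁻¹ := fun n => by positivity
  choose F hFc hF1 hF using fun n => hG.exists_almost_invariant_set (E.isCompact n) (hδ n)
  refine ⟨F, ⟨fun n => ⟨hFc n, Measure.measure_pos_of_mem_nhds μ (hF1 n)⟩, fun C hC => ?_⟩, hF1⟩
  obtain ⟨N, hN⟩ := E.exists_superset_of_isCompact hC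
  have hlim : Tendsto (fun n : ℕ => ENNReal.ofReal (1 / ((n : ℝ) + 1))) atTop (𝓝 0) := by
    simpa using ENNReal.tendsto_ofReal (tendsto_one_div_add_atTop_nhds_zero_nat (𝕜 := ℝ))
  refine tendsto_of_tendsto_of_tendsto_of_le_of_le' tendsto_const_nhds hlim
    (Eventually.of_forall fun n => zero_le) ?_
  filter_upwards [eventually_ge_atTop N] with n hn
  refine ENNReal.div_le_of_le_mul (iSup₂_le fun g hg => iSup₂_le fun h hh => ?_)
  rw [measure_image_mul_mul_symmDiff]
  have hsub := hN.trans (E.subset hn)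
  refine (hF n g (hsub hg) h (hsub hh)).trans (le_of_eq ?_)
  congr 2
  field_simp

end LevelSets

end

/-! ### The main theorem. -/

theorem theorem4p2 {G : Type u} [Group G] [TopologicalSpace G] [IsTopologicalGroup G]
    [T2Space G] [LocallyCompactSpace G] [SecondCountableTopology G]
    [MeasurableSpace G] [BorelSpace G]
    (μ : Measure G) [μ.IsHaarMeasure] [μ.IsMulRightInvariant] (hG : IsAmenable μ) :
    -- one Følner sequence that serves all irreducible unitary representations
    (∃ F : ℕ → Set G, IsGroupFolner μ F ∧
      (∀ (V : Type v) [NormedAddCommGroup V] [InnerProductSpace ℂ V] [CompleteSpace V]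
        (π : UnitaryRep G V), π.IsIrreducible →
        ((π.IsCTempered μ F ∧
            ∀ v w : V, v ≠ 0 → w ≠ 0 →
              AsympEquiv (fun n => π.energy μ (F n) v w) (fun n => μ (F n))) ↔
          FiniteDimensional ℂ V)) ∧
      (∀ (V : Type v) [NormedAddCommGroup V] [InnerProductSpace ℂ V] [CompleteSpace V]
        [FiniteDimensional ℂ V] (π : UnitaryRep G V), π.IsIrreducible →
        ∀ v₁ v₂ w₁ w₂ : V,
          Tendsto (fun n => ((μ.real (F n) : ℂ))⁻¹ *
              ∫ g in F n, π.coeff v₁ v₂ g * conj (π.coeff w₁ w₂ g) ∂μ) atTop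
            (𝓝 ((Module.finrank ℂ V : ℂ)⁻¹ * (inner ℂ w₁ v₁ * conj (inner ℂ w₂ v₂))))) ∧
      (∀ (V W : Type v) [NormedAddCommGroup V] [InnerProductSpace ℂ V] [CompleteSpace V]
        [FiniteDimensional ℂ V]
        [NormedAddCommGroup W] [InnerProductSpace ℂ W] [CompleteSpace W]
        [FiniteDimensional ℂ W]
        (π : UnitaryRep G V) (ρ : UnitaryRep G W), π.IsIrreducible → ρ.IsIrreducible →
        ¬ π.Equivalent ρ → ∀ (v₁ v₂ : V) (w₁ w₂ : W),
          Tendsto (fun n => ((μ.real (F n) : ℂ))⁻¹ *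
              ∫ g in F n, π.coeff v₁ v₂ g * conj (ρ.coeff w₁ w₂ g) ∂μ) atTop (𝓝 0)) ∧
      (∀ (V : Type v) [NormedAddCommGroup V] [InnerProductSpace ℂ V] [CompleteSpace V]
        [FiniteDimensional ℂ V] (π : UnitaryRep G V), π.IsIrreducible →
          Tendsto (fun n => ContinuousLinearMapWOT.ofCLM
              (((μ.real (F n) : ℂ))⁻¹ • ∫ g in F n, π.braidTwist g ∂μ)) atTop
            (𝓝 (ContinuousLinearMapWOT.ofCLM
              ((Module.finrank ℂ V : ℂ)⁻¹ • braiding V))))) ∧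
    -- no other Følner sequence can work for an infinite-dimensional representation
    (∀ F : ℕ → Set G, IsGroupFolner μ F →
      ∀ (V : Type v) [NormedAddCommGroup V] [InnerProductSpace ℂ V] [CompleteSpace V]
        (π : UnitaryRep G V), π.IsIrreducible → π.IsCTempered μ F →
        (∀ v w : V, v ≠ 0 → w ≠ 0 →
          AsympEquiv (fun n => π.energy μ (F n) v w) (fun n => μ (F n))) →
        FiniteDimensional ℂ V) := by
  refine ⟨?_, fun F hF V _ _ _ π hπ _ h => ?_⟩
  · obtain ⟨F, hF, h1⟩ := exists_isGroupFolner_mem_nhds_one μ hG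
    refine ⟨F, hF, fun V _ _ _ π hπ => ⟨fun h => ?_, fun _ =>
      ⟨hπ.isCTempered hF h1, fun v w hv hw => hπ.asympEquiv_energy hF hv hw⟩⟩,
      fun V _ _ _ _ π hπ v₁ v₂ w₁ w₂ => ?_,
      fun V W _ _ _ _ _ _ _ _ π ρ hπ hρ hne v₁ v₂ w₁ w₂ =>
        hπ.tendsto_setMean_of_not_equivalent hρ hne hF v₁ v₂ w₁ w₂,
      fun V _ _ _ _ π hπ => hπ.tendsto_braidTwist hF⟩
    · have := hπ.1
      obtain ⟨v, hv⟩ := exists_ne (0 : V)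
      exact hπ.finiteDimensional_of_liminf_pos hF v (h.2 v v hv hv).1
    · rw [inner_conj_symm]
      exact hπ.tendsto_setMean hF v₁ v₂ w₁ w₂
  · have := hπ.1
    obtain ⟨v, hv⟩ := exists_ne (0 : V)
    exact hπ.finiteDimensional_of_liminf_pos hF v (h v v hv hv).1
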